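/- **Setting.** Let $(\Omega,\mathbb P)$ be a probability space, $\Lambda$ an abelian group (for example the torus $\mathbb T^d$) with a $\sigma$-algebra and a finite measure $dx$, $K:\Lambda\to\mathbb R$ an even function, and $X=(X(x))_{x\in\Lambda}$ a real, centred, jointly measurable Gaussian field with $\mathbb E[X(x)X(y)]=K(x-y)$ for all $x,y\in\Lambda$. Write $H_k(X(x))$ for the $k$-th Hermite polynomial (Wick power) of $X(x)$ with variance parameter $c=\mathrm{Var}(X(x))$, that is $H_0=1$, $H_1(u)=u$, $H_{k+2}(u)=u\,H_{k+1}(u)-(k+1)\,c\,H_k(u)$; for $c>0$ this is $H_k(u)=(-c)^k e^{u^2/2c}\frac{d^k}{du^k}e^{-u^2/2c}$. Let $\alpha=(\alpha_k)_{k\in\mathbb N}$, $\mathbb N=\{0,1,2,\dots\}$, be formal commuting variables. **Diagrams.** $\mathbf F$ is the set of isomorphism classes of finite connected non-empty multigraphs $\Gamma=(\mathcal V,\mathcal E)$ without self-connections (edges joining a vertex to itself); the one-vertex graph without edges is included. Let $\beta(\Gamma,k)$ be the number of vertices of $\Gamma$ attached to exactly $k$ edges. Let $N(\Gamma)$ be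 the number of ways to pair all half-edges of the pre-Feynman diagram consisting of $\beta(\Gamma,k)$ vertices with $k$ distinguishable half-edges, for each $k$, in such a way that only half-edges of different vertices are paired and the resulting multigraph is isomorphic to $\Gamma$. Put $$\Pi_{\mathbf F}(\Gamma)=\int_{\Lambda^{\mathcal V}}\prod_{e\in\mathcal E}K(x_{e_+}-x_{e_-})\,dx,\qquad \Upsilon^\alpha_{\mathbf F}(\Gamma)=\prod_{k\in\mathbb N}(-\alpha_k)^{\beta(\Gamma,k)},\qquad \hat S_{\mathbf F}(\Gamma)=\prod_{k\in\mathbb N}\beta(\Gamma,k)!\,.$$ **Lemma.** Almost surely all integrals $\int_\Lambda H_k(X(x))\,dx$ converge absolutely; all coefficients of the random formal power series $\exp\bigl(-\int_\Lambda\sum_k\alpha_kH_k(X(x))\,dx\bigr)$ in $\alpha$ are integrable; all integrals $\Pi_{\mathbf F}(\Gamma)$ converge absolutely; for every finitely supported $m:\mathbb N\to\mathbb N$ only finitely many $\Gamma\in\mathbf F$ have $\beta(\Gamma,\cdot)=m$; and, as an identity of formal power series in the variables $\alpha_k$, with integrals, expectation and the sum over $\mathbf F$ taken coefficientwise, $$\log\mathbb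 E\Bigl[\exp\Bigl(-\int_\Lambda\sum_{k\in\mathbb N}\alpha_kH_k(X(x))\,dx\Bigr)\Bigr]=\sum_{\Gamma\in\mathbf F}\frac{\Upsilon^\alpha_{\mathbf F}(\Gamma)\,N(\Gamma)}{\hat S_{\mathbf F}(\Gamma)}\,\Pi_{\mathbf F}(\Gamma).$$ -/

import Mathlib

open MeasureTheory ProbabilityTheory
open scoped MvPowerSeries.WithPiTopology

noncomputable section

/-! ### Wick powers -/

/-- The `n`-th Hermite polynomial `H_n(x)` with variance parameter `c`, i.e. the `n`-th Wick power
of a centred Gaussian variable of variance `c`: `H_0 = 1`, `H_1 = x`,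
`H_{n+2} = x H_{n+1} - (n+1) c H_n`. -/
def hermiteVar (c : ℝ) : ℕ → ℝ → ℝ
  | 0, _ => 1
  | 1, x => x
  | n + 2, x => x * hermiteVar c (n + 1) x - (n + 1) * c * hermiteVar c n x

/-- `H_{n+1}' = (n+1) H_n`. -/
theorem hasDerivAt_hermiteVar (c : ℝ) (n : ℕ) (x : ℝ) :
    HasDerivAt (hermiteVar c (n + 1)) ((n + 1) * hermiteVar c n x) x := by
  induction n using Nat.strong_induction_on generalizing x with
  | _ n ih =>
    match n with
    | 0 => simpa [hermiteVar] using hasDerivAt_id' x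
    | 1 =>
      have h1 := ((hasDerivAt_id x).mul (hasDerivAt_id x)).sub_const (1 * c * 1)
      refine HasDerivAt.congr_of_eventuallyEq (h1.congr_deriv ?_) (.of_forall fun y => ?_)
      · simp [hermiteVar]; ring
      · simp [hermiteVar]
    | m + 2 =>
      have h1 := ih (m + 1) (by omega) x
      have h2 := ih m (by omega) x
      have h3 := ((hasDerivAt_id x).mul h1).sub (h2.const_mul (((m + 1 : ℕ) + 1 : ℝ) * c))
      refine HasDerivAt.congr_of_eventuallyEq (h3.congr_deriv ?_) (.of_forall fun y => ?_)
      · simp only [hermiteVar, id]; push_cast; ring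
      · simp [hermiteVar]

/-- Rodrigues' formula `H_n(x) = (-c)^n exp(x²/2c) (d/dx)^n exp(-x²/2c)` for positive variance. -/
theorem hermiteVar_eq_rodrigues (c : ℝ) (hc : 0 < c) (n : ℕ) (x : ℝ) :
    hermiteVar c n x = (-c) ^ n * Real.exp (x ^ 2 / (2 * c)) *
      iteratedDeriv n (fun y => Real.exp (-y ^ 2 / (2 * c))) x := by
  have key : ∀ n, iteratedDeriv n (fun y => Real.exp (-y ^ 2 / (2 * c))) =
      fun y => (-c)⁻¹ ^ n * (hermiteVar c n y * Real.exp (-y ^ 2 / (2 * c))) := by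
    intro n
    induction n with
    | zero => ext y; simp [hermiteVar]
    | succ n ih =>
      rw [iteratedDeriv_succ, ih]
      ext y
      have he : HasDerivAt (fun y : ℝ => Real.exp (-y ^ 2 / (2 * c)))
          (Real.exp (-y ^ 2 / (2 * c)) * (-(2 * y) / (2 * c))) y := by
        have := (((hasDerivAt_pow 2 y).neg).div_const (2 * c)).exp
        simpa using this
      cases n with
      | zero =>
        have h := he.const_mul 1
        simp only [hermiteVar, pow_zero, one_mul] at h ⊢
        rw [h.deriv, zero_add, pow_one]
        field_simp
      | succ n =>
        have h := ((hasDerivAt_hermiteVar c n y).mul he).const_mul ((-c)⁻¹ ^ (n + 1))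
        have h' : deriv (fun y => (-c)⁻¹ ^ (n + 1) *
            (hermiteVar c (n + 1) y * Real.exp (-y ^ 2 / (2 * c)))) y = _ := h.deriv
        rw [h', pow_succ (-c)⁻¹ (n + 1)]
        simp only [hermiteVar]
        field_simp
        ring
  rw [key]
  have h1 : (-c) ^ n * (-c)⁻¹ ^ n = 1 := by
    rw [← mul_pow, mul_inv_cancel₀ (by linarith), one_pow]
  have h2 : Real.exp (x ^ 2 / (2 * c)) * Real.exp (-x ^ 2 / (2 * c)) = 1 := by
    rw [← Real.exp_add, neg_div, add_neg_cancel, Real.exp_zero]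
  linear_combination (-hermiteVar c n x * Real.exp (x ^ 2 / (2 * c)) *
    Real.exp (-x ^ 2 / (2 * c))) * h1 - hermiteVar c n x * h2

/-! ### The partition function as a formal power series in the couplings `α_0, α_1, …` -/

/-- The linear form `∑_k c_k α_k` in the formal variables `α_k`. -/
def linearForm (c : ℕ → ℝ) : MvPowerSeries ℕ ℝ :=
  fun m => if m.degree = 1 then m.sum fun k a => a * c k else 0

theorem hasSum_linearForm (c : ℕ → ℝ) :
    HasSum (fun k => MvPowerSeries.C (c k) * MvPowerSeries.X k) (linearForm c) := by
  classical
  rw [MvPowerSeries.WithPiTopology.hasSum_iff_hasSum_coeff]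
  intro m
  simp only [MvPowerSeries.coeff_C_mul, MvPowerSeries.coeff_X]
  by_cases h : m.degree = 1
  · have hm : m ∈ Set.range fun k : ℕ => Finsupp.single k 1 := by
      rw [Finsupp.range_single_one]; exact h
    obtain ⟨k, hk⟩ := hm
    have hk' : m = Finsupp.single k 1 := hk.symm
    subst hk'
    have : MvPowerSeries.coeff (Finsupp.single k 1) (linearForm c) = c k := by
      change linearForm c _ = _
      simp [linearForm]
    rw [this]
    have h1 := hasSum_single (f := fun j => c j *
      (if Finsupp.single k 1 = Finsupp.single j 1 then (1 : ℝ) else 0)) k (fun j hj => by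
        simp [Finsupp.single_left_inj, hj.symm])
    simpa using h1
  · have : MvPowerSeries.coeff m (linearForm c) = 0 := by
      change linearForm c m = _
      simp [linearForm, h]
    rw [this]
    convert hasSum_zero using 2 with j
    rw [if_neg, mul_zero]
    rintro rfl
    simp at h

/-- Coefficientwise integration of formal power series in the couplings. -/
def coeffIntegral {E : Type*} [MeasurableSpace E] (ν : Measure E)
    (F : E → MvPowerSeries ℕ ℝ) : MvPowerSeries ℕ ℝ :=
  fun m => ∫ e, MvPowerSeries.coeff m (F e) ∂ν

/-- `exp(a)` for a formal series `a` without constant term. -/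
def formalExp (a : MvPowerSeries ℕ ℝ) : MvPowerSeries ℕ ℝ :=
  PowerSeries.subst a (PowerSeries.exp ℝ)

/-- `log(f) = ∑_{n ≥ 1} (-1)^{n+1} (f - 1)^n / n` for a formal series `f` with constant term `1`. -/
def formalLog (f : MvPowerSeries ℕ ℝ) : MvPowerSeries ℕ ℝ :=
  PowerSeries.subst (f - 1) (PowerSeries.log ℝ)

/-- The Wick power `H_k(X(x))` of a centred random field. -/
def wickPower {Λ Ω : Type*} [MeasurableSpace Ω] (P : Measure Ω) (X : Λ → Ω → ℝ)
    (k : ℕ) (x : Λ) (ω : Ω) : ℝ :=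
  hermiteVar (Var[X x; P]) k (X x ω)

/-- The random formal series `exp(-∫_Λ ∑_k α_k H_k(X(x)) dx)` in the couplings `α_k`. -/
def gibbsFactor {Λ Ω : Type*} [MeasurableSpace Λ] [MeasurableSpace Ω] (μ : Measure Λ)
    (P : Measure Ω) (X : Λ → Ω → ℝ) (ω : Ω) : MvPowerSeries ℕ ℝ :=
  formalExp (-coeffIntegral μ fun x => linearForm fun k => wickPower P X k x ω)

/-! ### Feynman diagrams -/

/-- Two multigraphs, given by their multisets of edges on the vertex sets `V` and `W`, are
isomorphic: some bijection of the vertices carries the edges of one to the edges of the other. -/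
def EdgesIso {V W : Type*} (E : Multiset (Sym2 V)) (E' : Multiset (Sym2 W)) : Prop :=
  ∃ f : V ≃ W, E.map (Sym2.map f) = E'

theorem EdgesIso.refl {V : Type*} (E : Multiset (Sym2 V)) : EdgesIso E E :=
  ⟨Equiv.refl V, by simp⟩

theorem EdgesIso.symm {V W : Type*} {E : Multiset (Sym2 V)} {E' : Multiset (Sym2 W)}
    (h : EdgesIso E E') : EdgesIso E' E := by
  obtain ⟨f, rfl⟩ := h
  exact ⟨f.symm, by simp [Multiset.map_map, Sym2.map_map]⟩

theorem EdgesIso.trans {V W U : Type*} {E : Multiset (Sym2 V)} {E' : Multiset (Sym2 W)}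
    {E'' : Multiset (Sym2 U)} (h : EdgesIso E E') (h' : EdgesIso E' E'') : EdgesIso E E'' := by
  obtain ⟨f, rfl⟩ := h
  obtain ⟨g, rfl⟩ := h'
  exact ⟨f.trans g, by simp [Multiset.map_map, Sym2.map_comp]⟩

/-- A labelled connected vacuum diagram: a finite connected multigraph without self-connections
(and without legs or free legs). Connectedness includes that there is at least one vertex. -/
structure LabelledDiagram where
  /-- the number of vertices -/
  n : ℕ
  /-- the edges, with multiplicity -/
  edges : Multiset (Sym2 (Fin n))
  loopless : ∀ e ∈ edges, ¬ e.IsDiag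
  connected : (SimpleGraph.fromEdgeSet {e | e ∈ edges}).Connected

namespace LabelledDiagram

/-- The number of edges attached to the vertex `v`. -/
def arity (Γ : LabelledDiagram) (v : Fin Γ.n) : ℕ :=
  Γ.edges.countP fun e => v ∈ e

/-- The counting map `Φ(Γ) = ∏_v z_{k(v)}`, as the exponent `β(Γ, ·)` of the monomial: its value
at `k` is the number of vertices of arity `k`. -/
def counting (Γ : LabelledDiagram) : ℕ →₀ ℕ :=
  ∑ v, Finsupp.single (Γ.arity v) 1

/-- The integrand `∏_{e ∈ E} K(x_{e₊} - x_{e₋})`; as `K` is even, the orientation of the edges is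
irrelevant. -/
def integrand {Λ : Type*} [AddCommGroup Λ] (K : Λ → ℝ) (hK : Function.Even K)
    (Γ : LabelledDiagram) (x : Fin Γ.n → Λ) : ℝ :=
  (Γ.edges.map (Sym2.lift ⟨fun v w => K (x v - x w),
    fun v w => by
    simpa only [neg_sub] using (hK (x v - x w)).symm⟩)).prod

/-- The valuation `∫_{Λ^V} ∏_{e ∈ E} K(x_{e₊} - x_{e₋}) dx`. -/
def valuation {Λ : Type*} [AddCommGroup Λ] [MeasurableSpace Λ] (μ : Measure Λ) (K : Λ → ℝ)
    (hK : Function.Even K) (Γ : LabelledDiagram) : ℝ :=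
  ∫ x, Γ.integrand K hK x ∂(Measure.pi fun _ => μ)

instance setoid : Setoid LabelledDiagram where
  r Γ Γ' := EdgesIso Γ.edges Γ'.edges
  iseqv := ⟨fun Γ => .refl Γ.edges, .symm, .trans⟩

end LabelledDiagram

/-- The vertices of the pre-Feynman diagram `z^β`: `β k` vertices of arity `k` for each `k`. -/
abbrev PreVertex (β : ℕ →₀ ℕ) : Type := Σ k : ℕ, Fin (β k)

/-- The half-edges of the pre-Feynman diagram `z^β`: a vertex of arity `k` carries `k` of them. -/
abbrev HalfEdge (β : ℕ →₀ ℕ) : Type := Σ v : PreVertex β, Fin v.1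

/-- `p` is a pairing of all half-edges in which only half-edges of different vertices are
paired. -/
def IsPairing {β : ℕ →₀ ℕ} (p : Finset (Sym2 (HalfEdge β))) : Prop :=
  (∀ h, ∃! e, e ∈ p ∧ h ∈ e) ∧ ∀ e ∈ p, ¬ (e.map Sigma.fst).IsDiag

/-- The edges of the multigraph formed by a pairing of half-edges. -/
def pairingEdges {β : ℕ →₀ ℕ} (p : Finset (Sym2 (HalfEdge β))) : Multiset (Sym2 (PreVertex β)) :=
  p.val.map (Sym2.map Sigma.fst)

/-- The number of pairings of the half-edges of the pre-Feynman diagram `Φ(Γ)` that form a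
diagram isomorphic to `Γ`. -/
def LabelledDiagram.numPairings (Γ : LabelledDiagram) : ℕ :=
  Nat.card {p : Finset (Sym2 (HalfEdge Γ.counting)) //
    IsPairing p ∧ EdgesIso (pairingEdges p) Γ.edges}

namespace LabelledDiagram

theorem counting_congr {Γ Γ' : LabelledDiagram} (h : Γ ≈ Γ') : Γ.counting = Γ'.counting := by
  obtain ⟨f, hf⟩ := h
  refine Fintype.sum_equiv f _ _ fun v => ?_
  have : Γ.arity v = Γ'.arity (f v) := by
    unfold arity
    rw [← hf, Multiset.countP_map, Multiset.countP_eq_card_filter]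
    congr 1
    refine Multiset.filter_congr fun e _ => ?_
    simp [Sym2.mem_map]
  rw [this]

theorem numPairings_congr {Γ Γ' : LabelledDiagram} (h : Γ ≈ Γ') :
    Γ.numPairings = Γ'.numPairings := by
  have h' : EdgesIso Γ.edges Γ'.edges := h
  unfold numPairings
  rw [counting_congr h]
  congr 1
  have : ∀ p : Finset (Sym2 (HalfEdge Γ'.counting)),
      (IsPairing p ∧ EdgesIso (pairingEdges p) Γ.edges) ↔
      (IsPairing p ∧ EdgesIso (pairingEdges p) Γ'.edges) := fun p =>
    and_congr_right fun _ => ⟨fun hp => hp.trans h', fun hp => hp.trans h'.symm⟩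
  simp only [this]

theorem valuation_congr {Λ : Type*} [AddCommGroup Λ] [MeasurableSpace Λ] (μ : Measure Λ)
    [SigmaFinite μ] (K : Λ → ℝ) (hK : Function.Even K) {Γ Γ' : LabelledDiagram} (h : Γ ≈ Γ') :
    Γ.valuation μ K hK = Γ'.valuation μ K hK := by
  obtain ⟨f, hf⟩ := h
  unfold valuation
  have hm := measurePreserving_piCongrLeft (fun _ : Fin Γ'.n => μ) f
  rw [← hm.integral_comp (MeasurableEquiv.measurableEmbedding _)]
  congr 1
  ext x
  have hx : ∀ v, MeasurableEquiv.piCongrLeft (fun _ => Λ) f x (f v) = x v := fun v =>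
    Equiv.piCongrLeft_apply_apply (fun _ : Fin Γ'.n => Λ) f x v
  unfold integrand
  rw [← hf, Multiset.map_map]
  congr 1
  refine Multiset.map_congr rfl fun e _ => ?_
  induction e with
  | _ v w => simp [hx]

end LabelledDiagram

/-- The set `𝐅` of connected Feynman diagrams, isomorphic diagrams being identified. -/
def FeynmanDiagram : Type := Quotient LabelledDiagram.setoid

namespace FeynmanDiagram

/-- `β(Γ, k)` is the number of vertices of `Γ` of arity `k`, the frequency of `z_k` in `Φ(Γ)`. -/
def β (Γ : FeynmanDiagram) : ℕ →₀ ℕ :=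
  Quotient.lift LabelledDiagram.counting (fun _ _ => LabelledDiagram.counting_congr) Γ

/-- `N(Γ)`. -/
def N (Γ : FeynmanDiagram) : ℕ :=
  Quotient.lift LabelledDiagram.numPairings (fun _ _ => LabelledDiagram.numPairings_congr) Γ

/-- The valuation `Π_𝐅(Γ)`. -/
def valuation {Λ : Type*} [AddCommGroup Λ] [MeasurableSpace Λ] (μ : Measure Λ) [SigmaFinite μ]
    (K : Λ → ℝ) (hK : Function.Even K) (Γ : FeynmanDiagram) : ℝ :=
  Quotient.lift (LabelledDiagram.valuation μ K hK)
    (fun _ _ => LabelledDiagram.valuation_congr μ K hK) Γ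

/-- `Υ^α_𝐅(Γ) = ∏_k (-α_k)^{β(Γ,k)}`, a monomial in the formal couplings. -/
def upsilon (Γ : FeynmanDiagram) : MvPowerSeries ℕ ℝ :=
  Γ.β.prod fun k b => (-MvPowerSeries.X k) ^ b

/-- `Ŝ_𝐅(Γ) = ∏_k β(Γ,k)!`. -/
def sHat (Γ : FeynmanDiagram) : ℕ :=
  Γ.β.prod fun _ b => b.factorial

end FeynmanDiagram

end

/-!
The coefficient of `α^m` in the random series is, up to the sign `(-1)^{|m|}` and the factor `1/m!`,
the product over the vertices `v` of the pre-Feynman diagram `z^m` of the random variables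
`∫ H_{k(v)}(X(x)) dx`. By Fubini and Wick's theorem its expectation is the sum, over all pairings of
the half-edges without self-contractions, of the integrals of the resulting multigraphs. The
logarithm keeps exactly the connected pairings, and sorting these by isomorphism class gives the
factors `N(Γ)`.

*Wick's theorem* (`integral_prod_hermiteVar_eq_sum_pairings`) follows from Gaussian integration by
parts. The latter is established against imaginary exponentials of the Gaussian vector: for the
constant function `1` it is the derivative of the characteristic function (`steinPair_one`), and
differentiating the formula in the phase shows that it survives multiplication by a coordinate
(`SteinPair.mul_coord`). Applied to a product of Wick powers, the contraction of two half-edges at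
the same vertex cancels against the recursion of the Hermite polynomials, so that a half-edge is
paired with the half-edges of all other vertices; pairings satisfy the same recursion
(`sum_edgeWeight_pairings`).

*The logarithm* is computed through logarithmic derivatives (`formalLog_eq_of_pderiv`). Read as
exponential generating functions, products of series are convolutions over subsets of a vertex set
(`egfCoeff_mul`), and `∂_k` marks a vertex of arity `k`. Splitting off the connected component of
the marked vertex (`sum_pairings_eq_sum_component`, `pairingSum_eq_sum`) says that
`∂_k Z = ∂_k W * Z`, where `Z` counts all pairings and `W` the connected ones
(`formalLog_coeffIntegral_gibbsFactor`).

All integrability statements come from one fact: the field at a random point has, up to the total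
mass, the law of a single centred Gaussian variable, hence all moments
(`IsStationaryGaussianField.hasAllMoments_prod`).
-/

noncomputable section

/-! ### Formal exponentials and logarithms -/

open scoped Nat in
/-- The multi-index factorial `m! = ∏_k m_k!`. -/
def multiFactorial (m : ℕ →₀ ℕ) : ℕ := m.prod fun _ b => b !

theorem multiFactorial_ne_zero (m : ℕ →₀ ℕ) : multiFactorial m ≠ 0 :=
  Finset.prod_ne_zero_iff.2 fun _ _ => Nat.factorial_ne_zero _

theorem multiFactorial_zero : multiFactorial 0 = 1 := by simp [multiFactorial]

theorem multiFactorial_add_single (m : ℕ →₀ ℕ) (k : ℕ) :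
    multiFactorial (m + Finsupp.single k 1) = (m k + 1) * multiFactorial m := by
  have h : ∀ n : ℕ →₀ ℕ, n.support ⊆ m.support ∪ {k} →
      multiFactorial n = ∏ j ∈ m.support ∪ {k}, (n j).factorial := fun n hn =>
    Finsupp.prod_of_support_subset _ hn _ (by simp)
  rw [h m Finset.subset_union_left, h _ (Finsupp.support_add.trans
    (Finset.union_subset_union_right Finsupp.support_single_subset)),
    ← Finset.mul_prod_erase _ _ (show k ∈ m.support ∪ {k} by simp),
    ← Finset.mul_prod_erase (m.support ∪ {k}) (fun j => (m j).factorial)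
      (show k ∈ m.support ∪ {k} by simp), ← mul_assoc]
  congr 1
  · simp [Nat.factorial_succ]
  · refine Finset.prod_congr rfl fun j hj => ?_
    rw [Finsupp.add_apply, Finsupp.single_eq_of_ne (Finset.ne_of_mem_erase hj), add_zero]

/-- The chain rule for substitution of a multivariate series into a univariate one. -/
theorem pderiv_subst {σ : Type*} (k : σ) (f : PowerSeries ℝ) {a : MvPowerSeries σ ℝ}
    (ha : PowerSeries.HasSubst a) :
    MvPowerSeries.pderiv ℝ k (f.subst a) =
      (PowerSeries.derivative ℝ f).subst a * MvPowerSeries.pderiv ℝ k a := by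
  classical
  have key : ∀ p : Polynomial ℝ, MvPowerSeries.pderiv ℝ k ((p : PowerSeries ℝ).subst a) =
      (PowerSeries.derivative ℝ (p : PowerSeries ℝ)).subst a * MvPowerSeries.pderiv ℝ k a := by
    intro p
    rw [PowerSeries.subst_coe ha, PowerSeries.derivative_coe, PowerSeries.subst_coe ha,
      ← smul_eq_mul, Derivation.map_aeval]
  ext n
  have hev : ∀ n : σ →₀ ℕ, ∃ m, ∀ d ≥ m, MvPowerSeries.coeff n (a ^ d) = 0 := by
    intro n
    have hfin := PowerSeries.coeff_subst_finite ha (PowerSeries.mk fun _ => (1 : ℝ)) n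
    obtain ⟨B, hB⟩ := hfin.bddAbove
    refine ⟨B + 1, fun d hd => ?_⟩
    by_contra h
    have : d ∈ Function.support fun d : ℕ =>
      PowerSeries.coeff d (PowerSeries.mk fun _ => (1 : ℝ)) • MvPowerSeries.coeff n (a ^ d) := by
      simpa using h
    have := hB this
    omega
  choose M hM using hev
  -- a degree beyond which no power of `a` affects the coefficients involved
  obtain ⟨N, hN⟩ : ∃ N, M (n + Finsupp.single k 1) ≤ N ∧
      ∀ q ∈ Finset.HasAntidiagonal.antidiagonal n, M q.1 ≤ N :=
    ⟨max (M (n + Finsupp.single k 1)) ((Finset.HasAntidiagonal.antidiagonal n).sup fun q => M q.1),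
      le_max_left _ _, fun q hq => le_max_of_le_right
        (Finset.le_sup (f := fun q : (σ →₀ ℕ) × (σ →₀ ℕ) => M q.1) hq)⟩
  have htr : MvPowerSeries.coeff (n + Finsupp.single k 1) (f.subst a) =
      MvPowerSeries.coeff (n + Finsupp.single k 1)
        ((PowerSeries.trunc (N + 1) f : PowerSeries ℝ).subst a) := by
    rw [PowerSeries.coeff_subst ha, PowerSeries.coeff_subst ha]
    refine finsum_congr fun d => ?_
    obtain hd | hd := lt_or_ge d N
    · rw [PowerSeries.coeff_coe_trunc_of_lt (by omega)]
    · rw [hM _ d (hN.1.trans hd), smul_zero, smul_zero]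
  rw [MvPowerSeries.coeff_pderiv, htr, ← MvPowerSeries.coeff_pderiv, key,
    MvPowerSeries.coeff_mul, MvPowerSeries.coeff_mul]
  refine Finset.sum_congr rfl fun q hq => ?_
  congr 1
  rw [PowerSeries.coeff_subst ha, PowerSeries.coeff_subst ha]
  refine finsum_congr fun d => ?_
  obtain hd | hd := lt_or_ge d N
  · rw [PowerSeries.coeff_derivative, PowerSeries.coeff_derivative,
      PowerSeries.coeff_coe_trunc_of_lt (by omega)]
  · rw [hM _ d ((hN.2 q hq).trans hd), smul_zero, smul_zero]

/-- A series `W` without constant term whose partial derivatives are the logarithmic derivatives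
of `Z` is the logarithm of `Z`. -/
theorem formalLog_eq_of_pderiv {Z W : MvPowerSeries ℕ ℝ} (hZ : MvPowerSeries.constantCoeff Z = 1)
    (hW : MvPowerSeries.constantCoeff W = 0)
    (h : ∀ k, MvPowerSeries.pderiv ℝ k Z = MvPowerSeries.pderiv ℝ k W * Z) :
    formalLog Z = W := by
  have h0 : MvPowerSeries.constantCoeff (Z - 1) = 0 := by simp [hZ]
  have ha : PowerSeries.HasSubst (Z - 1) := PowerSeries.HasSubst.of_constantCoeff_zero h0
  have hgeom : PowerSeries.derivative ℝ (PowerSeries.log ℝ) * (1 + PowerSeries.X) = 1 := by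
    rw [PowerSeries.deriv_log, mul_add, mul_one]
    ext n
    cases n with
    | zero => simp
    | succ n => simp [PowerSeries.coeff_succ_mul_X, PowerSeries.coeff_one, pow_succ]
  have hsub : (PowerSeries.derivative ℝ (PowerSeries.log ℝ)).subst (Z - 1) * Z = 1 := by
    have := congrArg (PowerSeries.substAlgHom (R := ℝ) ha) hgeom
    rw [map_mul, map_add, map_one, PowerSeries.substAlgHom_X, add_sub_cancel,
      PowerSeries.coe_substAlgHom] at this
    exact this
  refine MvPowerSeries.pderiv.ext (fun k => ?_) ?_
  · rw [formalLog, pderiv_subst k _ ha, map_sub, MvPowerSeries.pderiv_one, sub_zero, h,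
      mul_left_comm, hsub, mul_one]
  · rw [hW, formalLog]
    exact PowerSeries.constantCoeff_subst_eq_zero h0 _ PowerSeries.constantCoeff_log

theorem coeff_linearForm_single (c : ℕ → ℝ) (k : ℕ) :
    MvPowerSeries.coeff (Finsupp.single k 1) (linearForm c) = c k := by
  change linearForm c _ = _
  simp [linearForm]

theorem coeff_linearForm_of_degree_ne (c : ℕ → ℝ) {m : ℕ →₀ ℕ} (hm : m.degree ≠ 1) :
    MvPowerSeries.coeff m (linearForm c) = 0 := by
  change linearForm c _ = _
  simp [linearForm, hm]

theorem pderiv_linearForm (c : ℕ → ℝ) (k : ℕ) :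
    MvPowerSeries.pderiv ℝ k (linearForm c) = MvPowerSeries.C (c k) := by
  classical
  ext m
  rw [MvPowerSeries.coeff_pderiv, MvPowerSeries.coeff_C]
  split_ifs with hm
  · simp [hm, coeff_linearForm_single]
  · rw [coeff_linearForm_of_degree_ne, zero_mul]
    intro h
    rw [map_add, Finsupp.degree_single, Nat.add_eq_right,
      Finsupp.degree_eq_zero_iff] at h
    exact hm h

/-- The coefficients of the exponential of a linear form: `m! [α^m] exp(∑_k c_k α_k) = c^m`. -/
theorem multiFactorial_mul_coeff_formalExp_linearForm (c : ℕ → ℝ) (m : ℕ →₀ ℕ) :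
    (multiFactorial m : ℝ) * MvPowerSeries.coeff m (formalExp (linearForm c)) =
      m.prod fun k b => c k ^ b := by
  have h0 : MvPowerSeries.constantCoeff (linearForm c) = 0 := by
    rw [← MvPowerSeries.coeff_zero_eq_constantCoeff_apply]
    exact coeff_linearForm_of_degree_ne c (by simp)
  have ha : PowerSeries.HasSubst (linearForm c) := PowerSeries.HasSubst.of_constantCoeff_zero h0
  have hd : ∀ k, MvPowerSeries.pderiv ℝ k (formalExp (linearForm c)) =
      formalExp (linearForm c) * MvPowerSeries.C (c k) := by
    intro k
    rw [formalExp, pderiv_subst k _ ha, PowerSeries.derivative_exp, pderiv_linearForm]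
  have hstep : ∀ (m : ℕ →₀ ℕ) (k : ℕ), (multiFactorial m : ℝ) * MvPowerSeries.coeff m
      (formalExp (linearForm c)) = (m.prod fun k b => c k ^ b) →
      (multiFactorial (m + Finsupp.single k 1) : ℝ) * MvPowerSeries.coeff (m + Finsupp.single k 1)
      (formalExp (linearForm c)) = (m + Finsupp.single k 1).prod fun k b => c k ^ b := by
    intro m k hm
    have h1 := congrArg (MvPowerSeries.coeff m) (hd k)
    rw [MvPowerSeries.coeff_pderiv, MvPowerSeries.coeff_mul_C] at h1
    rw [multiFactorial_add_single, Finsupp.prod_add_index' (by simp) (by simp [pow_add]), ← hm,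
      Finsupp.prod_single_index (by simp)]
    push_cast
    linear_combination (multiFactorial m : ℝ) * h1
  have hmul : ∀ (k b : ℕ) (m : ℕ →₀ ℕ), (multiFactorial m : ℝ) * MvPowerSeries.coeff m
      (formalExp (linearForm c)) = (m.prod fun k b => c k ^ b) →
      (multiFactorial (m + Finsupp.single k b) : ℝ) * MvPowerSeries.coeff (m + Finsupp.single k b)
      (formalExp (linearForm c)) = (m + Finsupp.single k b).prod fun k b => c k ^ b := by
    intro k b m hm
    induction b with
    | zero => simpa using hm
    | succ b ih => rw [Finsupp.single_add, ← add_assoc]; exact hstep _ _ ih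
  induction m using Finsupp.induction with
  | zero =>
    rw [multiFactorial_zero, MvPowerSeries.coeff_zero_eq_constantCoeff_apply, formalExp,
      PowerSeries.constantCoeff_subst ha, finsum_eq_single _ 0]
    · simp
    · intro d hd
      simp [h0, hd]
  | single_add k b m _ _ ih => rw [add_comm]; exact hmul k b m ih

/-! ### Exponential generating functions and set functions -/

/-- The number of elements of `S` of each arity, as a multi-index. -/
def arityCount {V : Type*} (a : V → ℕ) (S : Finset V) : ℕ →₀ ℕ :=
  ∑ v ∈ S, Finsupp.single (a v) 1

/-- The coefficient of a formal series regarded as an exponential generating function. -/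
def egfCoeff (f : MvPowerSeries ℕ ℝ) (m : ℕ →₀ ℕ) : ℝ :=
  multiFactorial m * MvPowerSeries.coeff m f

theorem egfCoeff_add (f g : MvPowerSeries ℕ ℝ) (m : ℕ →₀ ℕ) :
    egfCoeff (f + g) m = egfCoeff f m + egfCoeff g m := by
  simp [egfCoeff, mul_add]

theorem egfCoeff_pderiv (f : MvPowerSeries ℕ ℝ) (k : ℕ) (m : ℕ →₀ ℕ) :
    egfCoeff (MvPowerSeries.pderiv ℝ k f) m = egfCoeff f (m + Finsupp.single k 1) := by
  rw [egfCoeff, egfCoeff, MvPowerSeries.coeff_pderiv, multiFactorial_add_single]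
  push_cast
  ring

theorem arityCount_insert {V : Type*} [DecidableEq V] (a : V → ℕ) {S : Finset V} {v : V}
    (hv : v ∉ S) : arityCount a (insert v S) = arityCount a S + Finsupp.single (a v) 1 := by
  rw [arityCount, Finset.sum_insert hv, add_comm]; rfl

/-- Products of exponential generating functions are convolutions over subsets. -/
theorem egfCoeff_mul {V : Type*} [DecidableEq V] (a : V → ℕ) (f g : MvPowerSeries ℕ ℝ)
    (S : Finset V) :
    egfCoeff (f * g) (arityCount a S) =
      ∑ T ∈ S.powerset, egfCoeff f (arityCount a T) * egfCoeff g (arityCount a (S \ T)) := by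
  induction S using Finset.induction_on generalizing f g with
  | empty => simp [arityCount, egfCoeff, multiFactorial_zero]
  | insert v S hv ih =>
    rw [arityCount_insert a hv, ← egfCoeff_pderiv, Derivation.leibniz, smul_eq_mul, smul_eq_mul,
      egfCoeff_add, ih, mul_comm g, ih, Finset.sum_powerset_insert hv]
    congr 1
    · refine Finset.sum_congr rfl fun T hT => ?_
      have hvT : v ∉ T := fun h => hv (Finset.mem_powerset.1 hT h)
      rw [Finset.insert_sdiff_of_notMem _ hvT, arityCount_insert, egfCoeff_pderiv]
      simp [hv]
    · refine Finset.sum_congr rfl fun T hT => ?_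
      have hvT : v ∉ T := fun h => hv (Finset.mem_powerset.1 hT h)
      rw [arityCount_insert a hvT, egfCoeff_pderiv, Finset.insert_sdiff_insert,
        Finset.sdiff_insert_of_notMem hv]

/-! ### Pairings of half-edges -/

section Pairings

variable {H V : Type*}

/-- `p` pairs all half-edges in `T`, and no others, in such a way that paired half-edges sit at
different vertices; `π` sends a half-edge to its vertex. -/
def IsPairingOn (π : H → V) (T : Finset H) (p : Finset (Sym2 H)) : Prop :=
  (∀ e ∈ p, ∀ h ∈ e, h ∈ T) ∧ (∀ h ∈ T, ∃! e, e ∈ p ∧ h ∈ e) ∧ ∀ e ∈ p, ¬ (e.map π).IsDiag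

open Classical in
/-- The finite set of pairings of the half-edges in `T`. -/
def pairings (π : H → V) (T : Finset H) : Finset (Finset (Sym2 H)) :=
  T.sym2.powerset.filter (IsPairingOn π T)

/-- The product of the edge weights `κ` over the edges of the multigraph formed by `p`. -/
def edgeWeight (κ : Sym2 V → ℝ) (π : H → V) (p : Finset (Sym2 H)) : ℝ :=
  ∏ e ∈ p, κ (e.map π)

/-- The set of vertices `U` is a union of connected components of the multigraph formed by `p`. -/
def IsSaturated (π : H → V) (p : Finset (Sym2 H)) (U : Finset V) : Prop :=
  ∀ e ∈ p, ∀ h ∈ e, π h ∈ U → ∀ h' ∈ e, π h' ∈ U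

/-- The multigraph formed by `p` on the vertex set `S` is connected: `S` is its only nonempty
saturated subset. -/
def IsConnectedOn (π : H → V) (S : Finset V) (p : Finset (Sym2 H)) : Prop :=
  S.Nonempty ∧ ∀ U ⊆ S, U.Nonempty → IsSaturated π p U → U = S

open Classical in
/-- The half-edges at the vertices in `S`. -/
def halfEdgesAt [Fintype H] (π : H → V) (S : Finset V) : Finset H :=
  Finset.univ.filter fun h => π h ∈ S

open Classical in
/-- The pairings of the half-edges at the vertices in `S` that form a connected multigraph. -/
def connectedPairings [Fintype H] (π : H → V) (S : Finset V) : Finset (Finset (Sym2 H)) :=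
  (pairings π (halfEdgesAt π S)).filter (IsConnectedOn π S)

theorem mem_pairings {π : H → V} {T : Finset H} {p : Finset (Sym2 H)} :
    p ∈ pairings π T ↔ IsPairingOn π T p := by
  classical
  rw [pairings, Finset.mem_filter, Finset.mem_powerset, and_iff_right_iff_imp]
  exact fun hp e he => Finset.mem_sym2_iff.2 (hp.1 e he)

theorem mem_halfEdgesAt [Fintype H] {π : H → V} {S : Finset V} {h : H} :
    h ∈ halfEdgesAt π S ↔ π h ∈ S := by
  simp [halfEdgesAt]

theorem halfEdgesAt_univ [Fintype H] [Fintype V] (π : H → V) :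
    halfEdgesAt π Finset.univ = Finset.univ := by
  ext h
  simp [mem_halfEdgesAt]

theorem card_filter_fst_eq {ι : Type*} {β : ι → Type*} [Fintype (Σ i, β i)]
    (i : ι) [DecidablePred fun h : Σ i, β i => h.1 = i] [Fintype (β i)] :
    (Finset.univ.filter fun h : Σ i, β i => h.1 = i).card = Fintype.card (β i) := by
  have : (Finset.univ.filter fun h : Σ i, β i => h.1 = i) =
      Finset.univ.map (Function.Embedding.sigmaMk i) := by
    ext ⟨j, b⟩
    simp only [Finset.mem_filter, Finset.mem_univ, true_and, Finset.mem_map,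
      Function.Embedding.sigmaMk_apply]
    constructor
    · rintro rfl; exact ⟨b, rfl⟩
    · rintro ⟨b', hb⟩; exact (congrArg Sigma.fst hb).symm
  rw [this, Finset.card_map, Finset.card_univ]

theorem mem_connectedPairings [Fintype H] {π : H → V} {S : Finset V} {p : Finset (Sym2 H)} :
    p ∈ connectedPairings π S ↔ IsPairingOn π (halfEdgesAt π S) p ∧ IsConnectedOn π S p := by
  classical
  rw [connectedPairings, Finset.mem_filter, mem_pairings]

theorem IsPairingOn.eq_of_mem {π : H → V} {T : Finset H} {p : Finset (Sym2 H)}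
    (hp : IsPairingOn π T p) {e e' : Sym2 H} (he : e ∈ p) (he' : e' ∈ p) {h : H} (h1 : h ∈ e)
    (h2 : h ∈ e') : e = e' :=
  (hp.2.1 h (hp.1 e he h h1)).unique ⟨he, h1⟩ ⟨he', h2⟩

theorem pairings_empty (π : H → V) : pairings π ∅ = {∅} := by
  ext p
  rw [mem_pairings, Finset.mem_singleton]
  constructor
  · refine fun hp => Finset.eq_empty_of_forall_notMem fun e he => ?_
    induction e with
    | _ h h' => simpa using hp.1 _ he h (Sym2.mem_mk_left h h')
  · rintro rfl
    simp [IsPairingOn]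

theorem IsPairingOn.disjoint {π : H → V} {T T' : Finset H} {p p' : Finset (Sym2 H)}
    (hp : IsPairingOn π T p) (hp' : IsPairingOn π T' p') (hT : Disjoint T T') : Disjoint p p' := by
  rw [Finset.disjoint_left]
  intro e he he'
  induction e with
  | _ h h' =>
    exact Finset.disjoint_left.1 hT (hp.1 _ he h (Sym2.mem_mk_left h h'))
      (hp'.1 _ he' h (Sym2.mem_mk_left h h'))

/-- A pairing restricts to a set `A` of half-edges which is a union of its pairs. -/
theorem IsPairingOn.restrict {π : H → V} {T A : Finset H} {p p' : Finset (Sym2 H)}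
    (hp : IsPairingOn π T p) (hA : A ⊆ T) (hp' : ∀ e, e ∈ p' ↔ e ∈ p ∧ ∀ h ∈ e, h ∈ A)
    (hsat : ∀ e ∈ p, ∀ h ∈ e, h ∈ A → ∀ h' ∈ e, h' ∈ A) : IsPairingOn π A p' := by
  refine ⟨fun e he => ((hp' e).1 he).2, fun h hh => ?_, fun e he => hp.2.2 e ((hp' e).1 he).1⟩
  obtain ⟨e, ⟨he, hhe⟩, hu⟩ := hp.2.1 h (hA hh)
  exact ⟨e, ⟨(hp' e).2 ⟨he, hsat e he h hhe hh⟩, hhe⟩,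
    fun e' he' => hu e' ⟨((hp' e').1 he'.1).1, he'.2⟩⟩

variable [DecidableEq H]

theorem IsPairingOn.union {π : H → V} {T T' : Finset H} {p p' : Finset (Sym2 H)}
    (hp : IsPairingOn π T p) (hp' : IsPairingOn π T' p') (hT : Disjoint T T') :
    IsPairingOn π (T ∪ T') (p ∪ p') := by
  refine ⟨fun e he h hh => ?_, fun h hh => ?_, fun e he => ?_⟩
  · rcases Finset.mem_union.1 he with he | he
    · exact Finset.mem_union_left _ (hp.1 e he h hh)
    · exact Finset.mem_union_right _ (hp'.1 e he h hh)
  · rcases Finset.mem_union.1 hh with hh | hh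
    · obtain ⟨e, ⟨he, hhe⟩, hu⟩ := hp.2.1 h hh
      refine ⟨e, ⟨Finset.mem_union_left _ he, hhe⟩, fun e' he' => ?_⟩
      rcases Finset.mem_union.1 he'.1 with h1 | h1
      · exact hu e' ⟨h1, he'.2⟩
      · exact absurd (hp'.1 e' h1 h he'.2) (Finset.disjoint_left.1 hT hh)
    · obtain ⟨e, ⟨he, hhe⟩, hu⟩ := hp'.2.1 h hh
      refine ⟨e, ⟨Finset.mem_union_right _ he, hhe⟩, fun e' he' => ?_⟩
      rcases Finset.mem_union.1 he'.1 with h1 | h1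
      · exact absurd hh (Finset.disjoint_left.1 hT (hp.1 e' h1 h he'.2))
      · exact hu e' ⟨h1, he'.2⟩
  · rcases Finset.mem_union.1 he with he | he
    · exact hp.2.2 e he
    · exact hp'.2.2 e he

theorem isPairingOn_pair {π : H → V} {h h' : H} (hne : π h ≠ π h') :
    IsPairingOn π {h, h'} {s(h, h')} := by
  refine ⟨?_, ?_, ?_⟩
  · simp
  · simp [ExistsUnique]
  · simpa using hne

/-- A sum over pairings, organised by the partner of a given half-edge `h`. -/
theorem sum_edgeWeight_pairings {π : H → V} (κ : Sym2 V → ℝ) [DecidableEq V] {T : Finset H} {h : H}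
    (hT : h ∈ T) :
    ∑ p ∈ pairings π T, edgeWeight κ π p =
      ∑ h' ∈ T.filter (fun h' => π h' ≠ π h), κ s(π h, π h') *
        ∑ p ∈ pairings π ((T.erase h).erase h'), edgeWeight κ π p := by
  simp_rw [Finset.mul_sum]
  rw [Finset.sum_sigma']
  have hdisj : ∀ h', Disjoint {h, h'} ((T.erase h).erase h') := fun h' => by
    rw [Finset.disjoint_left]; simp
  have hmem : ∀ (h' : H) (p : Finset (Sym2 H)), IsPairingOn π ((T.erase h).erase h') p →
      s(h, h') ∉ p := fun h' p hp hm => by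
    have := hp.1 _ hm h (Sym2.mem_mk_left h h')
    simp at this
  have hpair : ∀ (h' : H) (p : Finset (Sym2 H)), h' ∈ T → π h' ≠ π h →
      IsPairingOn π ((T.erase h).erase h') p → IsPairingOn π T (insert s(h, h') p) := by
    intro h' p hh' hne hp
    have h1 := (isPairingOn_pair hne.symm).union hp (hdisj h')
    have h2 : {h, h'} ∪ (T.erase h).erase h' = T := by
      ext x
      simp only [Finset.mem_union, Finset.mem_insert, Finset.mem_singleton, Finset.mem_erase]
      refine ⟨?_, fun hx => by tauto⟩
      rintro ((rfl | rfl) | hx) <;> tauto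
    rwa [h2] at h1
  symm
  refine Finset.sum_bij (fun x _ => insert s(h, x.1) x.2) ?_ ?_ ?_ ?_
  · rintro ⟨h', p⟩ hx
    simp only [Finset.mem_sigma, Finset.mem_filter, mem_pairings] at hx ⊢
    exact hpair h' p hx.1.1 hx.1.2 hx.2
  · rintro ⟨h₁, p₁⟩ hx ⟨h₂, p₂⟩ hy heq
    simp only [Finset.mem_sigma, Finset.mem_filter, mem_pairings] at hx hy heq
    have hP := hpair h₁ p₁ hx.1.1 hx.1.2 hx.2
    have he : s(h, h₁) = s(h, h₂) := hP.eq_of_mem (Finset.mem_insert_self _ _)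
      (by rw [heq]; exact Finset.mem_insert_self _ _) (Sym2.mem_mk_left h h₁)
      (Sym2.mem_mk_left h h₂)
    obtain rfl : h₁ = h₂ := Sym2.congr_right.1 he
    have := congrArg (fun q => q.erase s(h, h₁)) heq
    simp only [Finset.erase_insert (hmem _ _ hx.2), Finset.erase_insert (hmem _ _ hy.2)] at this
    rw [this]
  · intro p hp
    rw [mem_pairings] at hp
    obtain ⟨e, ⟨he, hhe⟩, -⟩ := hp.2.1 h hT
    obtain ⟨h', rfl⟩ := Sym2.mem_iff_exists.1 hhe
    have hne : π h' ≠ π h := fun h0 => hp.2.2 _ he (by simp [h0])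
    refine ⟨⟨h', p.erase s(h, h')⟩, ?_, Finset.insert_erase he⟩
    simp only [Finset.mem_sigma, Finset.mem_filter, mem_pairings]
    refine ⟨⟨hp.1 _ he h' (Sym2.mem_mk_right h h'), hne⟩,
      hp.restrict (fun x hx => Finset.mem_of_mem_erase (Finset.mem_of_mem_erase hx)) ?_ ?_⟩
    · intro e
      rw [Finset.mem_erase, and_comm, and_congr_right_iff]
      refine fun hep => ⟨fun hne x hx => ?_, fun hx h0 => ?_⟩
      · refine Finset.mem_erase.2 ⟨?_, Finset.mem_erase.2 ⟨?_, hp.1 e hep x hx⟩⟩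
        · rintro rfl; exact hne (hp.eq_of_mem hep he hx (Sym2.mem_mk_right _ _))
        · rintro rfl; exact hne (hp.eq_of_mem hep he hx (Sym2.mem_mk_left _ _))
      · subst h0
        simpa using hx h (Sym2.mem_mk_left _ _)
    · intro e hep x hx hxA y hy
      have hne : e ≠ s(h, h') := by
        rintro rfl
        rcases Sym2.mem_iff.1 hx with rfl | rfl <;> simp at hxA
      refine Finset.mem_erase.2 ⟨?_, Finset.mem_erase.2 ⟨?_, hp.1 e hep y hy⟩⟩
      · rintro rfl; exact hne (hp.eq_of_mem hep he hy (Sym2.mem_mk_right _ _))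
      · rintro rfl; exact hne (hp.eq_of_mem hep he hy (Sym2.mem_mk_left _ _))
  · rintro ⟨h', p⟩ hx
    simp only [Finset.mem_sigma, Finset.mem_filter, mem_pairings] at hx
    rw [edgeWeight, edgeWeight, Finset.prod_insert (hmem _ _ hx.2), Sym2.map_mk]

end Pairings

/-! ### Decomposition into connected components -/

section Components

variable {H V : Type*}

open Classical in
/-- The vertex set of the connected component of `v`: the smallest saturated set containing `v`. -/
def componentOf [Fintype V] (π : H → V) (p : Finset (Sym2 H)) (v : V) : Finset V :=
  Finset.univ.filter fun w => ∀ U, IsSaturated π p U → v ∈ U → w ∈ U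

theorem mem_componentOf [Fintype V] {π : H → V} {p : Finset (Sym2 H)} {v w : V} :
    w ∈ componentOf π p v ↔ ∀ U, IsSaturated π p U → v ∈ U → w ∈ U := by
  simp [componentOf]

theorem isSaturated_componentOf [Fintype V] (π : H → V) (p : Finset (Sym2 H)) (v : V) :
    IsSaturated π p (componentOf π p v) := by
  intro e he h hh hc h' hh'
  rw [mem_componentOf] at hc ⊢
  exact fun U hU hv => hU e he h hh (hc U hU hv) h' hh'

theorem IsSaturated.sdiff [DecidableEq V] {π : H → V} {p : Finset (Sym2 H)} {U U' : Finset V}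
    (hU : IsSaturated π p U) (hU' : IsSaturated π p U') : IsSaturated π p (U \ U') := by
  intro e he h hh hm h' hh'
  rw [Finset.mem_sdiff] at hm ⊢
  exact ⟨hU e he h hh hm.1 h' hh', fun h0 => hm.2 (hU' e he h' hh' h0 h hh)⟩

theorem isConnectedOn_componentOf [Fintype V] [DecidableEq V] (π : H → V)
    (p : Finset (Sym2 H)) (v : V) :
    IsConnectedOn π (componentOf π p v) p := by
  have hv : v ∈ componentOf π p v := mem_componentOf.2 fun U _ h => h
  refine ⟨⟨v, hv⟩, fun U hU hne hsat => Finset.Subset.antisymm hU ?_⟩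
  by_cases h : v ∈ U
  · exact fun w hw => mem_componentOf.1 hw U hsat h
  · exfalso
    obtain ⟨u, hu⟩ := hne
    have := mem_componentOf.1 (hU hu) _ ((isSaturated_componentOf π p v).sdiff hsat)
      (Finset.mem_sdiff.2 ⟨hv, h⟩)
    exact (Finset.mem_sdiff.1 this).2 hu

variable [Fintype H] [Fintype V] [DecidableEq V]

theorem disjoint_halfEdgesAt_compl (π : H → V) (S : Finset V) :
    Disjoint (halfEdgesAt π S) (halfEdgesAt π Sᶜ) := by
  rw [Finset.disjoint_left]
  simp [mem_halfEdgesAt]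

variable [DecidableEq H]

theorem halfEdgesAt_union_compl (π : H → V) (S : Finset V) :
    halfEdgesAt π S ∪ halfEdgesAt π Sᶜ = Finset.univ := by
  ext h
  simp [mem_halfEdgesAt, em]

/-- Every pairing decomposes uniquely into a connected pairing on a set of vertices containing a
given vertex `v` and a pairing on the remaining vertices. -/
theorem sum_pairings_eq_sum_component (π : H → V) (v : V) (f : Finset (Sym2 H) → ℝ) :
    ∑ p ∈ pairings π Finset.univ, f p =
      ∑ S ∈ Finset.univ.filter (fun S : Finset V => v ∈ S), ∑ q ∈ connectedPairings π S,
        ∑ r ∈ pairings π (halfEdgesAt π Sᶜ), f (q ∪ r) := by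
  rw [← Finset.sum_fiberwise_of_maps_to (g := fun p => componentOf π p v)
    (t := Finset.univ.filter (fun S : Finset V => v ∈ S))
    (fun p _ => by simpa using mem_componentOf.2 fun U _ h => h)]
  refine Finset.sum_congr rfl fun S hS => ?_
  replace hS : v ∈ S := by simpa using hS
  rw [← Finset.sum_product']
  have hlive : ∀ e : Sym2 H, ∃ h, h ∈ e := fun e => by
    induction e with
    | _ h h' => exact ⟨h, Sym2.mem_mk_left _ _⟩
  -- no edge joins the component of `v` to its complement
  have hglue : ∀ p, componentOf π p v = S → (p.filter fun e => ∀ h ∈ e, π h ∈ S) ∪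
      (p.filter fun e => ∀ h ∈ e, π h ∈ Sᶜ) = p := by
    rintro p rfl
    have hsat := isSaturated_componentOf π p v
    rw [← Finset.filter_or, Finset.filter_true_of_mem]
    intro e he
    obtain ⟨h, hh⟩ := hlive e
    by_cases hS' : π h ∈ componentOf π p v
    · exact .inl (hsat e he h hh hS')
    · exact .inr fun h' hh' => Finset.mem_compl.2 fun h0 => hS' (hsat e he h' hh' h0 h hh)
  refine Finset.sum_bij' (fun p _ => (p.filter fun e => ∀ h ∈ e, π h ∈ S,
    p.filter fun e => ∀ h ∈ e, π h ∈ Sᶜ)) (fun x _ => x.1 ∪ x.2) ?_ ?_ ?_ ?_ ?_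
  · intro p hp
    rw [Finset.mem_filter, mem_pairings] at hp
    obtain ⟨hp, rfl⟩ := hp
    have hsat := isSaturated_componentOf π p v
    rw [Finset.mem_product, mem_connectedPairings, mem_pairings]
    refine ⟨⟨hp.restrict (Finset.subset_univ _) (by simp [mem_halfEdgesAt]) ?_, ?_⟩,
      hp.restrict (Finset.subset_univ _) (by simp [mem_halfEdgesAt]) ?_⟩
    · intro e he h hh
      simpa only [mem_halfEdgesAt] using hsat e he h hh
    · refine ⟨⟨v, hS⟩, fun U hU hne hU' => (isConnectedOn_componentOf π p v).2 U hU hne ?_⟩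
      intro e he h hh hhU h' hh'
      exact hU' e (Finset.mem_filter.2 ⟨he, hsat e he h hh (hU hhU)⟩) h hh hhU h' hh'
    · intro e he h hh hhS h' hh'
      rw [mem_halfEdgesAt, Finset.mem_compl] at hhS ⊢
      exact fun h0 => hhS (hsat e he h' hh' h0 h hh)
  · rintro ⟨q, r⟩ hx
    rw [Finset.mem_product, mem_connectedPairings, mem_pairings] at hx
    obtain ⟨⟨hq, hqc⟩, hr⟩ := hx
    have hU := hq.union hr (disjoint_halfEdgesAt_compl π S)
    rw [halfEdgesAt_union_compl] at hU
    rw [Finset.mem_filter, mem_pairings]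
    refine ⟨hU, ?_⟩
    have hsat : IsSaturated π (q ∪ r) S := by
      intro e he h hh hhS h' hh'
      rcases Finset.mem_union.1 he with he | he
      · exact mem_halfEdgesAt.1 (hq.1 e he h' hh')
      · exact absurd hhS (Finset.mem_compl.1 (mem_halfEdgesAt.1 (hr.1 e he h hh)))
    refine hqc.2 _ (fun w hw => mem_componentOf.1 hw S hsat hS)
      ⟨v, mem_componentOf.2 fun U _ h => h⟩ fun e he => ?_
    exact isSaturated_componentOf π (q ∪ r) v e (Finset.mem_union_left _ he)
  · intro p hp
    exact hglue p (Finset.mem_filter.1 hp).2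
  · rintro ⟨q, r⟩ hx
    rw [Finset.mem_product, mem_connectedPairings, mem_pairings] at hx
    obtain ⟨⟨hq, hqc⟩, hr⟩ := hx
    have hqS : ∀ e ∈ q, ∀ h ∈ e, π h ∈ S := fun e he h hh => mem_halfEdgesAt.1 (hq.1 e he h hh)
    have hrS : ∀ e ∈ r, ∀ h ∈ e, π h ∉ S := fun e he h hh =>
      Finset.mem_compl.1 (mem_halfEdgesAt.1 (hr.1 e he h hh))
    refine Prod.ext ?_ ?_
    · ext e
      simp only [Finset.mem_filter, Finset.mem_union]
      refine ⟨?_, fun he => ⟨.inl he, hqS e he⟩⟩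
      rintro ⟨he | he, h⟩
      · exact he
      · obtain ⟨x, hx⟩ := hlive e
        exact absurd (h x hx) (hrS e he x hx)
    · ext e
      simp only [Finset.mem_filter, Finset.mem_union, Finset.mem_compl]
      refine ⟨?_, fun he => ⟨.inr he, hrS e he⟩⟩
      rintro ⟨he | he, h⟩
      · obtain ⟨x, hx⟩ := hlive e
        exact absurd (hqS e he x hx) (h x hx)
      · exact he
  · intro p hp
    exact congrArg f (hglue p (Finset.mem_filter.1 hp).2).symm

end Components

/-! ### Transport of pairings along embeddings -/

section Transport

variable {H V H' V' : Type*}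

theorem edgeWeight_map {π : H → V} {π' : H' → V'} {i : V' → V} {j : H' ↪ H}
    (hπ : ∀ h, π (j h) = i (π' h)) (κ : Sym2 V → ℝ) (p : Finset (Sym2 H')) :
    edgeWeight κ π (p.map j.sym2Map) = edgeWeight (fun e => κ (e.map i)) π' p := by
  rw [edgeWeight, edgeWeight, Finset.prod_map]
  refine Finset.prod_congr rfl fun e _ => ?_
  induction e with
  | _ h h' => simp [hπ]

theorem isPairingOn_map_iff {π : H → V} {π' : H' → V'} {i : V' ↪ V} {j : H' ↪ H}
    (hπ : ∀ h, π (j h) = i (π' h)) {T : Finset H'} {p : Finset (Sym2 H')} :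
    IsPairingOn π (T.map j) (p.map j.sym2Map) ↔ IsPairingOn π' T p := by
  have hmem : ∀ (h : H') (e : Sym2 H'), j h ∈ e.map j ↔ h ∈ e := fun h e => by
    simp [Sym2.mem_map]
  have hdiag : ∀ e : Sym2 H', ((e.map j).map π).IsDiag ↔ (e.map π').IsDiag := fun e => by
    induction e with
    | _ h h' => simp [hπ]
  have hex : ∀ h, (∃! e, e ∈ p.map j.sym2Map ∧ j h ∈ e) ↔ ∃! e, e ∈ p ∧ h ∈ e := by
    intro h
    constructor
    · rintro ⟨e, ⟨he, hhe⟩, hu⟩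
      obtain ⟨e', he', rfl⟩ := Finset.mem_map.1 he
      refine ⟨e', ⟨he', (hmem _ _).1 hhe⟩, fun e'' h'' => j.sym2Map.injective ?_⟩
      exact hu _ ⟨Finset.mem_map_of_mem _ h''.1, (hmem _ _).2 h''.2⟩
    · rintro ⟨e, ⟨he, hhe⟩, hu⟩
      refine ⟨j.sym2Map e, ⟨Finset.mem_map_of_mem _ he, (hmem _ _).2 hhe⟩, ?_⟩
      rintro e' ⟨he', hhe'⟩
      obtain ⟨e'', he'', rfl⟩ := Finset.mem_map.1 he'
      rw [hu e'' ⟨he'', (hmem _ _).1 hhe'⟩]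
  unfold IsPairingOn
  refine and_congr ?_ (and_congr ?_ ?_)
  · simp [Sym2.mem_map]
  · simp only [Finset.forall_mem_map, hex]
  · simp only [Finset.forall_mem_map, Function.Embedding.sym2Map_apply, hdiag]

theorem pairings_map {π : H → V} {π' : H' → V'} {i : V' ↪ V} {j : H' ↪ H}
    (hπ : ∀ h, π (j h) = i (π' h)) (T : Finset H') :
    pairings π (T.map j) = (pairings π' T).map (Finset.mapEmbedding j.sym2Map).toEmbedding := by
  ext p
  simp only [mem_pairings, Finset.mem_map, RelEmbedding.coe_toEmbedding,
    Finset.mapEmbedding_apply]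
  constructor
  · intro hp
    have hsub : p ⊆ T.sym2.map j.sym2Map := by
      rw [← Finset.sym2_map]
      exact fun e he => Finset.mem_sym2_iff.2 (hp.1 e he)
    obtain ⟨u, -, rfl⟩ := Finset.subset_map_iff.1 hsub
    exact ⟨u, (isPairingOn_map_iff hπ).1 hp, rfl⟩
  · rintro ⟨p', hp', rfl⟩
    exact (isPairingOn_map_iff hπ).2 hp'

theorem isConnectedOn_map_iff {π : H → V} {π' : H' → V'} {i : V' ↪ V} {j : H' ↪ H}
    (hπ : ∀ h, π (j h) = i (π' h)) {S : Finset V'} {p : Finset (Sym2 H')} :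
    IsConnectedOn π (S.map i) (p.map j.sym2Map) ↔ IsConnectedOn π' S p := by
  have hsat : ∀ U : Finset V', IsSaturated π (p.map j.sym2Map) (U.map i) ↔ IsSaturated π' p U := by
    intro U
    have hm : ∀ v, i v ∈ U.map i ↔ v ∈ U := fun v => Finset.mem_map' i
    have h2 : ∀ (e : Sym2 H') (Q : H → Prop), (∀ h ∈ j.sym2Map e, Q h) ↔ ∀ h ∈ e, Q (j h) :=
      fun e Q => by simp [Sym2.mem_map]
    simp only [IsSaturated, Finset.forall_mem_map, h2, hπ, hm]
  unfold IsConnectedOn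
  rw [Finset.map_nonempty]
  refine and_congr_right fun _ => ⟨fun h U hU hne hs => ?_, fun h U hU hne hs => ?_⟩
  · exact Finset.map_injective i (h _ (Finset.map_subset_map.2 hU) (hne.map) ((hsat U).2 hs))
  · obtain ⟨U', hU', rfl⟩ := Finset.subset_map_iff.1 hU
    rw [h U' hU' (Finset.map_nonempty.1 hne) ((hsat U').1 hs)]

variable [Fintype H] [Fintype H']

theorem halfEdgesAt_map {π : H → V} {π' : H' → V'} {i : V' ↪ V} {j : H' ↪ H}
    (hπ : ∀ h, π (j h) = i (π' h)) (hj : ∀ h, π h ∈ Set.range i → h ∈ Set.range j)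
    (S : Finset V') : halfEdgesAt π (S.map i) = (halfEdgesAt π' S).map j := by
  ext h
  simp only [mem_halfEdgesAt, Finset.mem_map]
  constructor
  · rintro ⟨v, hv, hvh⟩
    obtain ⟨h', rfl⟩ := hj h ⟨v, hvh⟩
    rw [hπ] at hvh
    exact ⟨h', i.injective hvh ▸ hv, rfl⟩
  · rintro ⟨h', hh', rfl⟩
    exact ⟨_, hh', (hπ h').symm⟩

theorem connectedPairings_map {π : H → V} {π' : H' → V'} {i : V' ↪ V} {j : H' ↪ H}
    (hπ : ∀ h, π (j h) = i (π' h)) (hj : ∀ h, π h ∈ Set.range i → h ∈ Set.range j)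
    (S : Finset V') : connectedPairings π (S.map i) =
      (connectedPairings π' S).map (Finset.mapEmbedding j.sym2Map).toEmbedding := by
  ext p
  rw [mem_connectedPairings, halfEdgesAt_map hπ hj, ← mem_pairings, pairings_map hπ]
  simp only [mem_connectedPairings, mem_pairings, Finset.mem_map, RelEmbedding.coe_toEmbedding,
    Finset.mapEmbedding_apply]
  constructor
  · rintro ⟨⟨p', hp', rfl⟩, hc⟩
    exact ⟨p', ⟨hp', (isConnectedOn_map_iff hπ).1 hc⟩, rfl⟩
  · rintro ⟨p', ⟨hp', hc⟩, rfl⟩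
    exact ⟨⟨p', hp', rfl⟩, (isConnectedOn_map_iff hπ).2 hc⟩

end Transport

/-! ### Gaussian integration by parts -/

section Gaussian

variable {Ω : Type*} [MeasurableSpace Ω] {P : Measure Ω}

open scoped ENNReal in
/-- All moments of `f` are finite. -/
def HasAllMoments (f : Ω → ℝ) (P : Measure Ω) : Prop := ∀ p : ℝ≥0∞, p ≠ ∞ → MemLp f p P

theorem HasAllMoments.add {f g : Ω → ℝ} (hf : HasAllMoments f P) (hg : HasAllMoments g P) :
    HasAllMoments (fun ω => f ω + g ω) P := fun p hp => (hf p hp).add (hg p hp)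

theorem HasAllMoments.const_mul {f : Ω → ℝ} (hf : HasAllMoments f P) (c : ℝ) :
    HasAllMoments (fun ω => c * f ω) P := fun p hp => (hf p hp).const_mul c

theorem hasAllMoments_const [IsFiniteMeasure P] (c : ℝ) : HasAllMoments (fun _ : Ω => c) P :=
  fun _ _ => memLp_const c

theorem HasAllMoments.mul {f g : Ω → ℝ} (hf : HasAllMoments f P) (hg : HasAllMoments g P) :
    HasAllMoments (fun ω => f ω * g ω) P := fun p hp => by
  have : ENNReal.HolderTriple (2 * p) (2 * p) p := ⟨by
    rw [ENNReal.mul_inv (by simp) (by simp), ← add_mul, ENNReal.inv_two_add_inv_two, one_mul]⟩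
  exact (hg (2 * p) (ENNReal.mul_ne_top (by simp) hp)).mul' (hf (2 * p)
    (ENNReal.mul_ne_top (by simp) hp))

theorem HasAllMoments.integrable {f : Ω → ℝ} (hf : HasAllMoments f P) : Integrable f P :=
  memLp_one_iff_integrable.1 (hf 1 (by simp))

theorem HasAllMoments.prod [IsFiniteMeasure P] {ι : Type*} {f : ι → Ω → ℝ} (S : Finset ι)
    (hf : ∀ i ∈ S, HasAllMoments (f i) P) : HasAllMoments (fun ω => ∏ i ∈ S, f i ω) P := by
  classical
  induction S using Finset.induction_on with
  | empty => simpa using hasAllMoments_const 1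
  | insert i S hi ih =>
    simp only [Finset.prod_insert hi]
    exact (hf i (by simp)).mul (ih fun j hj => hf j (by simp [hj]))

theorem HasAllMoments.hermiteVar [IsFiniteMeasure P] {f : Ω → ℝ} (hf : HasAllMoments f P) (c : ℝ)
    (n : ℕ) : HasAllMoments (fun ω => hermiteVar c n (f ω)) P := by
  induction n using Nat.strong_induction_on with
  | _ n ih =>
    match n with
    | 0 => exact hasAllMoments_const 1
    | 1 => exact hf
    | n + 2 =>
      have := (hf.mul (ih (n + 1) (by omega))).add
        ((ih n (by omega)).const_mul (-((n + 1) * c)))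
      refine cast ?_ this
      congr 1
      ext ω
      simp only [_root_.hermiteVar]
      ring

theorem integrable_mul_cexp {f L : Ω → ℝ} (hf : HasAllMoments f P) (hL : AEMeasurable L P) :
    Integrable (fun ω => (f ω : ℂ) * Complex.exp (Complex.I * L ω)) P := by
  refine hf.integrable.ofReal.mul_bdd (c := 1) ?_ (.of_forall fun ω => ?_)
  · exact (Complex.measurable_exp.comp_aemeasurable
      ((Complex.measurable_ofReal.comp_aemeasurable hL).const_mul _)).aestronglyMeasurable
  · rw [Complex.norm_exp_I_mul_ofReal]

/-- Differentiation of an oscillatory integral with respect to its phase. -/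
theorem hasDerivAt_integral_mul_cexp {f L Z : Ω → ℝ} (hf : HasAllMoments f P)
    (hZ : HasAllMoments Z P) (hL : AEMeasurable L P) :
    HasDerivAt (fun s : ℝ => ∫ ω, (f ω : ℂ) * Complex.exp (Complex.I * ↑(L ω + s * Z ω)) ∂P)
      (Complex.I * ∫ ω, ((Z ω * f ω : ℝ) : ℂ) * Complex.exp (Complex.I * L ω) ∂P) 0 := by
  have hZm : AEMeasurable Z P := (hZ 1 (by simp)).aestronglyMeasurable.aemeasurable
  have hLs : ∀ s : ℝ, AEMeasurable (fun ω => L ω + s * Z ω) P := fun s =>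
    hL.add (hZm.const_mul s)
  have key := hasDerivAt_integral_of_dominated_loc_of_deriv_le (μ := P) (𝕜 := ℝ) (x₀ := 0)
    (s := Set.univ) (bound := fun ω => |Z ω * f ω|)
    (F := fun s ω => (f ω : ℂ) * Complex.exp (Complex.I * ↑(L ω + s * Z ω)))
    (F' := fun s ω => Complex.I * (((Z ω * f ω : ℝ) : ℂ) *
      Complex.exp (Complex.I * ↑(L ω + s * Z ω)))) Filter.univ_mem
    (.of_forall fun s => (integrable_mul_cexp hf (hLs s)).aestronglyMeasurable)
    (integrable_mul_cexp hf (hLs 0))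
    ((integrable_mul_cexp (hZ.mul hf) (hLs 0)).const_mul _).aestronglyMeasurable
    (.of_forall fun ω s _ => ?_) (hZ.mul hf).integrable.abs (.of_forall fun ω s _ => ?_)
  · have := key.2
    simp only [zero_mul, add_zero] at this
    rwa [integral_const_mul] at this
  · rw [norm_mul, norm_mul, Complex.norm_exp_I_mul_ofReal, Complex.norm_I, Complex.norm_real,
      one_mul, mul_one, Real.norm_eq_abs]
  · have h1 : HasDerivAt (fun s : ℝ => L ω + s * Z ω) (Z ω) s := by
      simpa using ((hasDerivAt_id s).mul_const (Z ω)).const_add (L ω)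
    have h2 := ((h1.ofReal_comp.const_mul Complex.I).cexp).const_mul (f ω : ℂ)
    refine h2.congr_deriv ?_
    push_cast
    ring

variable {V : Type*} [Fintype V]

/-- The bilinear form with matrix `C`, applied to the basis vector at `v` and to `u`. -/
def covAt (C : V → V → ℝ) (v : V) (u : V → ℝ) : ℝ := ∑ w, u w * C v w

/-- `f'` plays the role of the directional derivative `∑_w C(v,w) ∂_w f`, in the sense that
Gaussian integration by parts in the direction `v` holds for `f` multiplied by an arbitrary
imaginary exponential of the Gaussian vector `Y`. -/
structure SteinPair (P : Measure Ω) (Y : V → Ω → ℝ) (C : V → V → ℝ) (v : V) (f f' : Ω → ℝ) :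
    Prop where
  moments : HasAllMoments f P
  moments' : HasAllMoments f' P
  ibp : ∀ u : V → ℝ,
    ∫ ω, ((Y v ω * f ω : ℝ) : ℂ) * Complex.exp (Complex.I * ↑(∑ w, u w * Y w ω)) ∂P =
      ∫ ω, (f' ω : ℂ) * Complex.exp (Complex.I * ↑(∑ w, u w * Y w ω)) ∂P +
      Complex.I * covAt C v u *
        ∫ ω, (f ω : ℂ) * Complex.exp (Complex.I * ↑(∑ w, u w * Y w ω)) ∂P

variable {Y : V → Ω → ℝ} {C : V → V → ℝ} {v : V}

theorem aemeasurable_linear (hY : ∀ v, HasAllMoments (Y v) P) (u : V → ℝ) :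
    AEMeasurable (fun ω => ∑ w, u w * Y w ω) P :=
  Finset.aemeasurable_fun_sum _ fun w _ =>
    ((hY w 1 (by simp)).aestronglyMeasurable.aemeasurable).const_mul _

theorem SteinPair.const_mul {f f' : Ω → ℝ} (h : SteinPair P Y C v f f') (c : ℝ) :
    SteinPair P Y C v (fun ω => c * f ω) (fun ω => c * f' ω) where
  moments := h.moments.const_mul c
  moments' := h.moments'.const_mul c
  ibp u := by
    have hc : ∀ g : Ω → ℝ, ∫ ω, ((c * g ω : ℝ) : ℂ) *
        Complex.exp (Complex.I * ↑(∑ w, u w * Y w ω)) ∂P =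
        c * ∫ ω, (g ω : ℂ) * Complex.exp (Complex.I * ↑(∑ w, u w * Y w ω)) ∂P := fun g => by
      simp only [Complex.ofReal_mul, mul_assoc, integral_const_mul]
    simp only [mul_left_comm (Y v _) c, hc, h.ibp u]
    ring

theorem SteinPair.add (hY : ∀ v, HasAllMoments (Y v) P) {f f' g g' : Ω → ℝ}
    (hf : SteinPair P Y C v f f') (hg : SteinPair P Y C v g g') :
    SteinPair P Y C v (fun ω => f ω + g ω) (fun ω => f' ω + g' ω) where
  moments := hf.moments.add hg.moments
  moments' := hf.moments'.add hg.moments'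
  ibp u := by
    have hu := aemeasurable_linear hY u
    simp only [mul_add, Complex.ofReal_add, add_mul]
    rw [integral_add (integrable_mul_cexp ((hY v).mul hf.moments) hu)
      (integrable_mul_cexp ((hY v).mul hg.moments) hu),
      integral_add (integrable_mul_cexp hf.moments' hu) (integrable_mul_cexp hg.moments' hu),
      integral_add (integrable_mul_cexp hf.moments hu) (integrable_mul_cexp hg.moments hu),
      hf.ibp, hg.ibp]
    ring

theorem sum_add_single_mul [DecidableEq V] (u : V → ℝ) (j : V) (s : ℝ) (y : V → ℝ) :
    ∑ w, (u + Pi.single j s : V → ℝ) w * y w = ∑ w, u w * y w + s * y j := by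
  simp [add_mul, Finset.sum_add_distrib, Pi.single_apply]

/-- Differentiating the integration by parts formula in the phase shows that it is stable under
multiplication by a coordinate of the Gaussian vector. -/
theorem SteinPair.mul_coord (hY : ∀ v, HasAllMoments (Y v) P) {f f' : Ω → ℝ}
    (h : SteinPair P Y C v f f') (j : V) :
    SteinPair P Y C v (fun ω => Y j ω * f ω) (fun ω => Y j ω * f' ω + C v j * f ω) where
  moments := (hY j).mul h.moments
  moments' := ((hY j).mul h.moments').add (h.moments.const_mul _)
  ibp u := by
    classical
    have hu := aemeasurable_linear hY u
    -- the formula for `f` with the phase shifted by `s` in the direction `j`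
    have hs : ∀ s : ℝ,
        ∫ ω, ((Y v ω * f ω : ℝ) : ℂ) *
          Complex.exp (Complex.I * ↑(∑ w, u w * Y w ω + s * Y j ω)) ∂P =
        ∫ ω, (f' ω : ℂ) * Complex.exp (Complex.I * ↑(∑ w, u w * Y w ω + s * Y j ω)) ∂P +
        (Complex.I * ↑(covAt C v u + s * C v j)) *
          ∫ ω, (f ω : ℂ) * Complex.exp (Complex.I * ↑(∑ w, u w * Y w ω + s * Y j ω)) ∂P := by
      intro s
      have := h.ibp (u + Pi.single j s)
      simpa only [covAt, sum_add_single_mul] using this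
    have d1 := hasDerivAt_integral_mul_cexp ((hY v).mul h.moments) (hY j) hu
    have d2 := hasDerivAt_integral_mul_cexp h.moments' (hY j) hu
    have d3 := hasDerivAt_integral_mul_cexp h.moments (hY j) hu
    have d4 : HasDerivAt (fun s : ℝ => Complex.I * ↑(covAt C v u + s * C v j))
        (Complex.I * (C v j : ℂ)) 0 := by
      have h1 : HasDerivAt (fun s : ℝ => covAt C v u + s * C v j) (C v j) 0 := by
        simpa using ((hasDerivAt_id (0 : ℝ)).mul_const (C v j)).const_add (covAt C v u)
      exact h1.ofReal_comp.const_mul _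
    have hder := d1.unique ((d2.add (d4.mul d3)).congr_of_eventuallyEq (.of_forall hs))
    simp only [zero_mul, add_zero] at hder
    have hsplit : ∫ ω, ((Y j ω * f' ω + C v j * f ω : ℝ) : ℂ) *
        Complex.exp (Complex.I * ↑(∑ w, u w * Y w ω)) ∂P =
        ∫ ω, ((Y j ω * f' ω : ℝ) : ℂ) * Complex.exp (Complex.I * ↑(∑ w, u w * Y w ω)) ∂P +
        C v j * ∫ ω, (f ω : ℂ) * Complex.exp (Complex.I * ↑(∑ w, u w * Y w ω)) ∂P := by
      rw [← integral_const_mul, ← integral_add (integrable_mul_cexp ((hY j).mul h.moments') hu)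
        ((integrable_mul_cexp h.moments hu).const_mul _)]
      congr 1
      ext ω
      push_cast
      ring
    rw [hsplit]
    simp only [mul_left_comm (Y v _)]
    refine mul_left_cancel₀ Complex.I_ne_zero ?_
    linear_combination hder

/-- The base case of Gaussian integration by parts, by differentiating the characteristic
function. -/
theorem steinPair_one [IsFiniteMeasure P] (hY : ∀ v, HasAllMoments (Y v) P)
    (hC : ∀ v w, C v w = C w v)
    (hchar : ∀ u : V → ℝ, ∫ ω, Complex.exp (Complex.I * ↑(∑ w, u w * Y w ω)) ∂P =
      Complex.exp (-(∑ w, u w * covAt C w u : ℝ) / 2)) (v : V) :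
    SteinPair P Y C v (fun _ => 1) (fun _ => 0) where
  moments := hasAllMoments_const 1
  moments' := hasAllMoments_const 0
  ibp u := by
    classical
    have hu := aemeasurable_linear hY u
    -- the characteristic function along the line through `u` in the direction `v`
    have hs : ∀ s : ℝ,
        ∫ ω, ((1 : ℝ) : ℂ) * Complex.exp (Complex.I * ↑(∑ w, u w * Y w ω + s * Y v ω)) ∂P =
        Complex.exp
          ((-(∑ w, u w * covAt C w u + 2 * s * covAt C v u + s ^ 2 * C v v) / 2 : ℝ) : ℂ) := by
      intro s
      have h1 := hchar (u + Pi.single v s)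
      rw [show ∑ w, (u + Pi.single v s : V → ℝ) w * covAt C w (u + Pi.single v s) =
        ∑ w, u w * covAt C w u + 2 * s * covAt C v u + s ^ 2 * C v v by
          rw [sum_add_single_mul]
          simp only [covAt, sum_add_single_mul, mul_add, Finset.sum_add_distrib]
          have : ∑ w, u w * (s * C w v) = s * ∑ w, u w * C v w := by
            rw [Finset.mul_sum]
            exact Finset.sum_congr rfl fun w _ => by rw [hC w v]; ring
          rw [this]
          ring] at h1
      simp only [sum_add_single_mul] at h1
      simp only [Complex.ofReal_one, one_mul]
      rw [h1]
      push_cast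
      ring_nf
    have d1 := hasDerivAt_integral_mul_cexp (hasAllMoments_const 1) (hY v) hu
    have d2 : HasDerivAt (fun s : ℝ => Complex.exp
        ((-(∑ w, u w * covAt C w u + 2 * s * covAt C v u + s ^ 2 * C v v) / 2 : ℝ) : ℂ))
        (Complex.exp ((-(∑ w, u w * covAt C w u) / 2 : ℝ) : ℂ) * ((-covAt C v u : ℝ) : ℂ)) 0 := by
      have h1 : HasDerivAt (fun s : ℝ =>
          -(∑ w, u w * covAt C w u + 2 * s * covAt C v u + s ^ 2 * C v v) / 2)
          (-covAt C v u) 0 := by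
        have := (((((hasDerivAt_id (0 : ℝ)).const_mul 2).mul_const (covAt C v u)).const_add
          (∑ w, u w * covAt C w u)).add
            ((hasDerivAt_pow 2 (0 : ℝ)).mul_const (C v v))).neg.div_const 2
        refine (this.congr_deriv ?_).congr_of_eventuallyEq (.of_forall fun s => ?_)
        · norm_num
          ring
        · simp [add_assoc]
      have h2 := h1.ofReal_comp.cexp
      simpa only [mul_zero, zero_mul, add_zero, ne_eq, OfNat.ofNat_ne_zero, not_false_eq_true,
        zero_pow] using h2
    have hder := d1.unique (d2.congr_of_eventuallyEq (.of_forall hs))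
    have h0 := hchar u
    simp only [Complex.ofReal_one, one_mul, Complex.ofReal_zero, zero_mul, integral_zero, zero_add,
      mul_one] at hder ⊢
    rw [h0]
    refine mul_left_cancel₀ Complex.I_ne_zero ?_
    rw [hder]
    push_cast
    linear_combination (-Complex.exp (-(∑ w, (u w : ℂ) * (covAt C w u : ℂ)) / 2) *
      (covAt C v u : ℂ)) * Complex.I_mul_I

theorem hermiteVar_succ (c : ℝ) (n : ℕ) (x : ℝ) :
    hermiteVar c (n + 1) x = x * hermiteVar c n x - n * c * hermiteVar c (n - 1) x := by
  cases n with
  | zero => simp [hermiteVar]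
  | succ n => simp [hermiteVar]

/-- The derivation property of `f ↦ f'` together with `H_n' = n H_{n-1}`. For `n = 0` the truncated
index `n - 1` is harmless because of the factor `n`. -/
theorem SteinPair.mul_hermiteVar (hY : ∀ v, HasAllMoments (Y v) P) {f f' : Ω → ℝ}
    (h : SteinPair P Y C v f f') (c : ℝ) (j : V) (n : ℕ) :
    SteinPair P Y C v (fun ω => hermiteVar c n (Y j ω) * f ω)
      (fun ω => hermiteVar c n (Y j ω) * f' ω +
        n * C v j * hermiteVar c (n - 1) (Y j ω) * f ω) := by
  induction n using Nat.strong_induction_on with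
  | _ n ih =>
    match n with
    | 0 => simpa [hermiteVar] using h
    | 1 => simpa [hermiteVar] using h.mul_coord hY j
    | n + 2 =>
      have h1 := ((ih (n + 1) (by omega)).mul_coord hY j).add hY
        ((ih n (by omega)).const_mul (-((n + 1) * c)))
      convert! h1 using 1
      · ext ω
        simp only [hermiteVar]
        ring
      · ext ω
        have h2 := hermiteVar_succ c n (Y j ω)
        simp only [Nat.add_succ_sub_one, add_tsub_cancel_right]
        rw [hermiteVar_succ c (n + 1), Nat.add_sub_cancel]
        push_cast
        linear_combination (C v j * (n + 1) * f ω) * h2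

/-- Gaussian integration by parts for products of Hermite polynomials. -/
theorem SteinPair.prod_hermiteVar [DecidableEq V] (hY : ∀ v, HasAllMoments (Y v) P)
    (h : SteinPair P Y C v (fun _ => 1) (fun _ => 0)) (c : V → ℝ) (n : V → ℕ) (S : Finset V) :
    SteinPair P Y C v (fun ω => ∏ w ∈ S, hermiteVar (c w) (n w) (Y w ω))
      (fun ω => ∑ w ∈ S, n w * C v w *
        ∏ x ∈ S, hermiteVar (c x) ((n - Pi.single w 1 : V → ℕ) x) (Y x ω)) := by
  induction S using Finset.induction_on with
  | empty => simpa using h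
  | insert a S ha ih =>
    convert! ih.mul_hermiteVar hY (c a) a (n a) using 1
    · ext ω
      rw [Finset.prod_insert ha]
    · ext ω
      rw [Finset.sum_insert ha, add_comm, Finset.mul_sum]
      congr 1
      · refine Finset.sum_congr rfl fun w hw => ?_
        have hne : a ≠ w := fun h0 => ha (h0 ▸ hw)
        rw [Finset.prod_insert ha, Pi.sub_apply, Pi.single_eq_of_ne hne, tsub_zero]
        ring
      · rw [Finset.prod_insert ha, Pi.sub_apply, Pi.single_eq_same, ← mul_assoc]
        congr 1
        refine Finset.prod_congr rfl fun x hx => ?_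
        have hne : x ≠ a := fun h0 => ha (h0 ▸ hx)
        rw [Pi.sub_apply, Pi.single_eq_of_ne hne, tsub_zero]

/-- Integration by parts removes a factor `Y_v` from one Wick power and the contraction of two
factors at the same vertex cancels against the recursion of the Hermite polynomials. -/
theorem integral_prod_hermiteVar_eq_sum [IsFiniteMeasure P] [DecidableEq V]
    (hY : ∀ v, HasAllMoments (Y v) P)
    (hS : ∀ v, SteinPair P Y C v (fun _ => 1) (fun _ => 0)) (n : V → ℕ) {v : V} (hv : n v ≠ 0) :
    ∫ ω, ∏ w, hermiteVar (C w w) (n w) (Y w ω) ∂P =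
      ∑ w ∈ Finset.univ.erase v, n w * (C v w * ∫ ω, ∏ x, hermiteVar (C x x)
        ((n - Pi.single v 1 - Pi.single w 1 : V → ℕ) x) (Y x ω) ∂P) := by
  set n' : V → ℕ := n - Pi.single v 1 with hn'
  obtain ⟨k, hk⟩ : ∃ k, n v = k + 1 := ⟨n v - 1, by omega⟩
  have hn'v : n' v = k := by simp [hn', hk]
  have hne : ∀ w, w ≠ v → n' w = n w := fun w hw => by simp [hn', hw]
  have hint : ∀ m : V → ℕ, HasAllMoments (fun ω => ∏ w, hermiteVar (C w w) (m w) (Y w ω)) P :=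
    fun m => HasAllMoments.prod _ fun w _ => (hY w).hermiteVar _ _
  have hpt : ∀ ω, ∏ w, hermiteVar (C w w) (n w) (Y w ω) =
      Y v ω * ∏ w, hermiteVar (C w w) (n' w) (Y w ω) - n' v * C v v *
        ∏ x, hermiteVar (C x x) ((n' - Pi.single v 1 : V → ℕ) x) (Y x ω) := by
    intro ω
    have hrest : ∀ m : V → ℕ, (∀ w, w ≠ v → m w = n w) →
        ∏ w, hermiteVar (C w w) (m w) (Y w ω) = hermiteVar (C v v) (m v) (Y v ω) *
          ∏ w ∈ Finset.univ.erase v, hermiteVar (C w w) (n w) (Y w ω) := by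
      intro m hm
      rw [← Finset.mul_prod_erase _ _ (Finset.mem_univ v)]
      congr 1
      exact Finset.prod_congr rfl fun w hw => by rw [hm w (Finset.ne_of_mem_erase hw)]
    rw [hrest n (fun _ _ => rfl), hrest n' hne, hrest (n' - Pi.single v 1)
      (fun w hw => by simp [hne w hw, hw]), hk, hermiteVar_succ, Pi.sub_apply, Pi.single_eq_same,
      hn'v]
    ring
  -- at phase `0` the exponential and its derivative disappear, leaving a real identity
  have hibp := ((hS v).prod_hermiteVar hY (fun w => C w w) n' Finset.univ).ibp 0
  simp only [covAt, Pi.zero_apply, zero_mul, Finset.sum_const_zero, Complex.ofReal_zero, mul_zero,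
    Complex.exp_zero, mul_one, add_zero, integral_complex_ofReal, Complex.ofReal_inj] at hibp
  simp_rw [hpt]
  rw [integral_sub ((hY v).mul (hint n')).integrable ((hint _).const_mul _).integrable, hibp,
    integral_finsetSum _ fun w _ => ((hint _).const_mul _).integrable, integral_const_mul,
    ← Finset.sum_erase_add _ _ (Finset.mem_univ v), integral_const_mul, add_sub_cancel_right]
  refine Finset.sum_congr rfl fun w hw => ?_
  rw [integral_const_mul, hne w (Finset.ne_of_mem_erase hw), mul_assoc]

/-! ### Wick's theorem -/

/-- Wick's theorem for products of Wick powers: the expectation is the sum over all pairings of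
the half-edges without self-contractions of the products of covariances. -/
theorem integral_prod_hermiteVar_eq_sum_pairings [IsProbabilityMeasure P] [DecidableEq V]
    (hY : ∀ v, HasAllMoments (Y v) P)
    (hS : ∀ v, SteinPair P Y C v (fun _ => 1) (fun _ => 0)) (κ : Sym2 V → ℝ)
    (hκ : ∀ v w, κ s(v, w) = C v w) {H : Type*} [DecidableEq H] (π : H → V) (T : Finset H) :
    ∫ ω, ∏ w, hermiteVar (C w w) (T.filter fun h => π h = w).card (Y w ω) ∂P =
      ∑ p ∈ pairings π T, edgeWeight κ π p := by
  induction hn : T.card using Nat.strong_induction_on generalizing T with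
  | _ n ih =>
  subst hn
  obtain rfl | ⟨h, hT⟩ := T.eq_empty_or_nonempty
  · simp [pairings_empty, edgeWeight, hermiteVar]
  have hcount : ∀ (T : Finset H) (h : H), h ∈ T →
      (fun w => ((T.erase h).filter fun h' => π h' = w).card) =
        (fun w => (T.filter fun h' => π h' = w).card) - (Pi.single (π h) 1 : V → ℕ) := by
    intro T h hT
    ext w
    rw [Pi.sub_apply, Finset.filter_erase, Finset.card_erase_eq_ite]
    by_cases hw : π h = w
    · subst hw; simp [hT]
    · simp [hT, hw, Ne.symm hw]
  rw [sum_edgeWeight_pairings κ hT, integral_prod_hermiteVar_eq_sum hY hS _ (v := π h)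
    (Finset.card_ne_zero.2 ⟨h, by simp [hT]⟩)]
  rw [← Finset.sum_fiberwise_of_maps_to (g := π) (t := Finset.univ.erase (π h))
    (fun h' hh' => by simpa using (Finset.mem_filter.1 hh').2)]
  refine Finset.sum_congr rfl fun w hw => ?_
  replace hw := Finset.ne_of_mem_erase hw
  have hfib : (T.filter fun h' => π h' ≠ π h).filter (fun h' => π h' = w) =
      T.filter fun h' => π h' = w := by
    ext x
    simp only [Finset.mem_filter]
    constructor
    · tauto
    · rintro ⟨h1, rfl⟩; exact ⟨⟨h1, hw⟩, rfl⟩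
  rw [hfib, ← nsmul_eq_mul, ← Finset.sum_const]
  refine Finset.sum_congr rfl fun h' hh' => ?_
  obtain ⟨hT', rfl⟩ := Finset.mem_filter.1 hh'
  have hmem : h' ∈ T.erase h := Finset.mem_erase.2 ⟨fun h0 => hw (by rw [h0]), hT'⟩
  rw [hκ, ← ih _ ?_ ((T.erase h).erase h') rfl, ← hcount T h hT, ← hcount _ h' hmem]
  exact (Finset.card_lt_card (Finset.erase_ssubset hmem)).trans
    (Finset.card_lt_card (Finset.erase_ssubset hT))

/-- A centred Gaussian vector satisfies Gaussian integration by parts. -/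
theorem steinPair_one_of_hasGaussianLaw (hG : HasGaussianLaw (fun ω v => Y v ω) P)
    (hmean : ∀ v, ∫ ω, Y v ω ∂P = 0) (hcov : ∀ v w, ∫ ω, Y v ω * Y w ω ∂P = C v w) (v : V) :
    SteinPair P Y C v (fun _ => 1) (fun _ => 0) := by
  have : IsProbabilityMeasure P := hG.isProbabilityMeasure
  have hY : ∀ v, HasAllMoments (Y v) P := fun v p hp => (hG.eval v).memLp hp
  refine steinPair_one hY (fun v w => ?_) (fun u => ?_) v
  · simp_rw [← hcov, mul_comm (Y v _)]
  · let L : StrongDual ℝ (V → ℝ) := ∑ w, u w • ContinuousLinearMap.proj w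
    have hL : ∀ y : V → ℝ, L y = ∑ w, u w * y w := fun y => by
      simp [L]
    have h1 := hG.charFunDual_map_eq_fun L
    rw [charFunDual_apply, integral_map hG.aemeasurable (by fun_prop)] at h1
    have h2 : ∫ ω, L (fun v => Y v ω) ∂P = 0 := by
      simp_rw [hL]
      rw [integral_finsetSum _ fun w _ => ((hY w).integrable.const_mul _)]
      simp [integral_const_mul, hmean]
    have h3 : Var[fun ω => L (fun v => Y v ω); P] = ∑ w, u w * covAt C w u := by
      have hm : AEMeasurable (fun ω => L fun v => Y v ω) P :=
        L.continuous.measurable.comp_aemeasurable hG.aemeasurable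
      rw [variance_of_integral_eq_zero hm h2]
      simp_rw [hL, sq, Finset.sum_mul_sum, covAt, Finset.mul_sum]
      have hi : ∀ w x, Integrable (fun ω => u w * Y w ω * (u x * Y x ω)) P := fun w x =>
        (((hY w).const_mul _).mul ((hY x).const_mul _)).integrable
      rw [integral_finsetSum _ fun w _ => integrable_finsetSum _ fun x _ => hi w x]
      refine Finset.sum_congr rfl fun w _ => ?_
      rw [integral_finsetSum _ fun x _ => hi w x]
      refine Finset.sum_congr rfl fun x _ => ?_
      rw [← hcov, ← integral_const_mul, ← integral_const_mul]
      congr 1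
      ext ω
      ring
    rw [h2, h3] at h1
    simp only [Complex.ofReal_zero, zero_mul, zero_sub] at h1
    simp_rw [hL] at h1
    simp_rw [mul_comm Complex.I]
    rw [h1]
    congr 1
    ring

end Gaussian

/-! ### Stationary Gaussian fields -/

/-- A jointly measurable centred Gaussian field with covariance `K (x - y)`. -/
structure IsStationaryGaussianField {Λ Ω : Type*} [AddCommGroup Λ] [MeasurableSpace Λ]
    [MeasurableSpace Ω] (X : Λ → Ω → ℝ) (K : Λ → ℝ) (P : Measure Ω) : Prop where
  measurable : Measurable (Function.uncurry X)
  gaussian : IsGaussianProcess X P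
  mean : ∀ x, ∫ ω, X x ω ∂P = 0
  cov : ∀ x y, ∫ ω, X x ω * X y ω ∂P = K (x - y)

/-- The random coefficient `∫_Λ H_k(X(x)) dx` of the coupling `α_k`. -/
def integratedWickPower {Λ Ω : Type*} [MeasurableSpace Λ] [MeasurableSpace Ω] (μ : Measure Λ)
    (P : Measure Ω) (X : Λ → Ω → ℝ) (k : ℕ) (ω : Ω) : ℝ :=
  ∫ x, wickPower P X k x ω ∂μ

theorem prod_integratedWickPower {Λ Ω : Type*} [MeasurableSpace Λ] [MeasurableSpace Ω]
    {P : Measure Ω} {X : Λ → Ω → ℝ} {V : Type*} [Fintype V] (μ : Measure Λ) [SigmaFinite μ]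
    (a : V → ℕ) (ω : Ω) :
    ∏ v, integratedWickPower μ P X (a v) ω =
      ∫ x : V → Λ, ∏ v, wickPower P X (a v) (x v) ω ∂(Measure.pi fun _ => μ) :=
  (integral_fintype_prod_eq_prod (μ := fun _ : V => μ)
    (fun v x => wickPower P X (a v) x ω)).symm

section KernelWeight

variable {Λ : Type*} [AddCommGroup Λ] {V V' : Type*}

/-- The weight `K(x_v - x_w)` of the edge `{v, w}`. -/
def kernelWeight (K : Λ → ℝ) (hK : Function.Even K) (x : V → Λ) : Sym2 V → ℝ :=
  Sym2.lift ⟨fun v w => K (x v - x w), fun v w => by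
    simpa only [neg_sub] using (hK (x v - x w)).symm⟩

theorem kernelWeight_mk (K : Λ → ℝ) (hK : Function.Even K) (x : V → Λ) (v w : V) :
    kernelWeight K hK x s(v, w) = K (x v - x w) := rfl

theorem kernelWeight_map (K : Λ → ℝ) (hK : Function.Even K) (x : V → Λ) (f : V' → V)
    (e : Sym2 V') : kernelWeight K hK x (e.map f) = kernelWeight K hK (x ∘ f) e := by
  induction e with
  | _ v w => rfl

end KernelWeight

section Field

variable {Λ Ω : Type*} [AddCommGroup Λ] [MeasurableSpace Λ] [MeasurableSpace Ω]
  {P : Measure Ω} {X : Λ → Ω → ℝ} {K : Λ → ℝ}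

namespace IsStationaryGaussianField

theorem isProbabilityMeasure (h : IsStationaryGaussianField X K P) : IsProbabilityMeasure P :=
  h.gaussian.isProbabilityMeasure

theorem hasAllMoments (h : IsStationaryGaussianField X K P) (x : Λ) : HasAllMoments (X x) P :=
  fun _ hp => (h.gaussian.hasGaussianLaw_eval x).memLp hp

theorem variance (h : IsStationaryGaussianField X K P) (x : Λ) : Var[X x; P] = K 0 := by
  rw [variance_of_integral_eq_zero (h.gaussian.aemeasurable x) (h.mean x), ← sub_self x, ← h.cov]
  simp_rw [sq]

theorem wickPower_eq (h : IsStationaryGaussianField X K P) (k : ℕ) (x : Λ) (ω : Ω) :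
    wickPower P X k x ω = hermiteVar (K 0) k (X x ω) := by
  rw [wickPower, h.variance]

theorem abs_kernel_le (h : IsStationaryGaussianField X K P) (z : Λ) : |K z| ≤ K 0 := by
  have h2 : ∀ x, Integrable (fun ω => X x ω * X x ω) P := fun x =>
    ((h.hasAllMoments x).mul (h.hasAllMoments x)).integrable
  calc |K z| = |∫ ω, X z ω * X 0 ω ∂P| := by rw [h.cov, sub_zero]
    _ ≤ ∫ ω, |X z ω * X 0 ω| ∂P := abs_integral_le_integral_abs
    _ ≤ ∫ ω, 2⁻¹ * (X z ω * X z ω + X 0 ω * X 0 ω) ∂P := by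
      refine integral_mono ((h.hasAllMoments z).mul (h.hasAllMoments 0)).integrable.abs
        (((h2 z).add (h2 0)).const_mul _) fun ω => ?_
      change |X z ω * X 0 ω| ≤ 2⁻¹ * (X z ω * X z ω + X 0 ω * X 0 ω)
      rw [abs_le]
      constructor <;> nlinarith [sq_nonneg (X z ω - X 0 ω), sq_nonneg (X z ω + X 0 ω)]
    _ = K 0 := by
      rw [integral_const_mul, integral_add (h2 z) (h2 0), h.cov, h.cov, sub_self, sub_self]
      ring

theorem measurable_kernel (h : IsStationaryGaussianField X K P) :
    Measurable fun q : Λ × Λ => K (q.1 - q.2) := by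
  have := h.isProbabilityMeasure
  have h1 : Measurable (Function.uncurry fun (q : Λ × Λ) ω => X q.1 ω * X q.2 ω) :=
    (h.measurable.comp (measurable_fst.fst.prodMk measurable_snd)).mul
      (h.measurable.comp (measurable_fst.snd.prodMk measurable_snd))
  have h2 := (h1.stronglyMeasurable.integral_prod_right (ν := P)).measurable
  simpa only [h.cov] using h2

/-- The field evaluated at a random point has all moments, since its law is the common law of the
values of the field. -/
theorem hasAllMoments_prod (h : IsStationaryGaussianField X K P) {S : Type*} [MeasurableSpace S]
    (ν : Measure S) [IsFiniteMeasure ν] {y : S → Λ} (hy : Measurable y) :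
    HasAllMoments (fun q : S × Ω => X (y q.1) q.2) (ν.prod P) := by
  have := h.isProbabilityMeasure
  have hm : Measurable fun q : S × Ω => X (y q.1) q.2 :=
    h.measurable.comp ((hy.comp measurable_fst).prodMk measurable_snd)
  have hlaw : (ν.prod P).map (fun q : S × Ω => X (y q.1) q.2) =
      ν Set.univ • gaussianReal 0 (K 0).toNNReal := by
    ext A hA
    have hx : ∀ x, P (X x ⁻¹' A) = gaussianReal 0 (K 0).toNNReal A := fun x => by
      rw [← Measure.map_apply_of_aemeasurable (h.gaussian.aemeasurable x) hA,
        (h.gaussian.hasGaussianLaw_eval x).map_eq_gaussianReal, h.mean, h.variance]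
    rw [Measure.map_apply hm hA, Measure.prod_apply (hm hA)]
    have : ∀ s, P (Prod.mk s ⁻¹' ((fun q : S × Ω => X (y q.1) q.2) ⁻¹' A)) =
        gaussianReal 0 (K 0).toNNReal A := fun s => hx (y s)
    simp_rw [this]
    rw [lintegral_const, Measure.smul_apply, smul_eq_mul, mul_comm]
  intro p hp
  have h1 : MemLp id p ((ν.prod P).map (fun q : S × Ω => X (y q.1) q.2)) := by
    rw [hlaw]
    exact (memLp_id_gaussianReal' p hp).smul_measure (measure_ne_top _ _)
  exact h1.comp_of_map hm.aemeasurable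

theorem integrable_prod_wickPower (h : IsStationaryGaussianField X K P) {S : Type*}
    [MeasurableSpace S] (ν : Measure S) [IsFiniteMeasure ν] {V : Type*} [Fintype V] (k : V → ℕ)
    {y : V → S → Λ} (hy : ∀ v, Measurable (y v)) :
    Integrable (fun q : S × Ω => ∏ v, wickPower P X (k v) (y v q.1) q.2) (ν.prod P) := by
  have := h.isProbabilityMeasure
  simp_rw [h.wickPower_eq]
  exact (HasAllMoments.prod _ fun v _ =>
    (h.hasAllMoments_prod ν (hy v)).hermiteVar (K 0) (k v)).integrable

theorem integrable_wickPower (h : IsStationaryGaussianField X K P) (μ : Measure Λ)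
    [IsFiniteMeasure μ] (k : ℕ) :
    Integrable (fun q : Λ × Ω => wickPower P X k q.1 q.2) (μ.prod P) := by
  simpa using h.integrable_prod_wickPower μ (fun _ : Unit => k) (y := fun _ x => x)
    fun _ => measurable_id

/-- The finite-dimensional marginals satisfy Gaussian integration by parts; the points need not be
distinct. -/
theorem steinPair (h : IsStationaryGaussianField X K P) {V : Type*} [Fintype V] (x : V → Λ)
    (v : V) : SteinPair P (fun v => X (x v)) (fun v w => K (x v - x w)) v
      (fun _ => 1) (fun _ => 0) := by
  refine steinPair_one_of_hasGaussianLaw ?_ (fun v => h.mean _) (fun v w => h.cov _ _) v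
  have h1 := (h.gaussian.comp_right x).hasGaussianLaw Finset.univ
  let L : ((↑(Finset.univ : Finset V) : Type _) → ℝ) →L[ℝ] (V → ℝ) :=
    ContinuousLinearMap.pi fun v => ContinuousLinearMap.proj ⟨v, Finset.mem_univ v⟩
  exact h1.map_fun L

end IsStationaryGaussianField

/-! ### Integrals attached to diagrams -/

section Kernel

variable {V V' : Type*} [Fintype V] [Fintype V']

theorem integrable_prod_kernelWeight (h : IsStationaryGaussianField X K P) (hK : Function.Even K)
    (μ : Measure Λ) [IsFiniteMeasure μ] (E : Multiset (Sym2 V)) :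
    Integrable (fun x : V → Λ => (E.map (kernelWeight K hK x)).prod) (Measure.pi fun _ => μ) := by
  suffices H : Measurable (fun x : V → Λ => (E.map (kernelWeight K hK x)).prod) ∧
      ∃ B : ℝ, ∀ x : V → Λ, ‖(E.map (kernelWeight K hK x)).prod‖ ≤ B by
    obtain ⟨hm, B, hB⟩ := H
    exact Integrable.of_bound hm.aestronglyMeasurable B (.of_forall hB)
  induction E using Multiset.induction_on with
  | empty => simpa using ⟨1, le_rfl⟩
  | cons e E ih =>
    obtain ⟨hm, B, hB⟩ := ih
    simp only [Multiset.map_cons, Multiset.prod_cons, norm_mul]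
    refine ⟨Measurable.mul ?_ hm, K 0 * B, fun x => mul_le_mul ?_ (hB x) (norm_nonneg _)
      ((abs_nonneg _).trans (h.abs_kernel_le 0))⟩
    · induction e with
      | _ v w =>
        have hvw : Measurable fun x : V → Λ => (x v, x w) :=
          (measurable_pi_apply v).prodMk (measurable_pi_apply w)
        exact h.measurable_kernel.comp hvw
    · induction e with
      | _ v w => exact h.abs_kernel_le _

/-- The integral over the positions of the vertices of the product of the edge weights of the
multigraph formed by `p`. -/
def diagramIntegral (μ : Measure Λ) (K : Λ → ℝ) (hK : Function.Even K) {H : Type*} (π : H → V)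
    (p : Finset (Sym2 H)) : ℝ :=
  ∫ x : V → Λ, edgeWeight (kernelWeight K hK x) π p ∂(Measure.pi fun _ => μ)

theorem integrable_edgeWeight (h : IsStationaryGaussianField X K P) (hK : Function.Even K)
    (μ : Measure Λ) [IsFiniteMeasure μ] {H : Type*} (π : H → V) (p : Finset (Sym2 H)) :
    Integrable (fun x : V → Λ => edgeWeight (kernelWeight K hK x) π p)
      (Measure.pi fun _ => μ) := by
  have := integrable_prod_kernelWeight h hK μ (p.val.map (Sym2.map π))
  simp only [Multiset.map_map] at this
  exact this

/-- Diagram integrals are invariant under relabelling of the vertices. -/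
theorem diagramIntegral_map_equiv (μ : Measure Λ) [SigmaFinite μ] (K : Λ → ℝ)
    (hK : Function.Even K) {H H' : Type*} {π : H → V} {π' : H' → V'} (i : V' ≃ V) (j : H' ↪ H)
    (hπ : ∀ h, π (j h) = i (π' h)) (p : Finset (Sym2 H')) :
    diagramIntegral μ K hK π (p.map j.sym2Map) = diagramIntegral μ K hK π' p := by
  unfold diagramIntegral
  rw [← (measurePreserving_piCongrLeft (fun _ : V => μ) i).integral_comp
    (MeasurableEquiv.measurableEmbedding _)]
  congr 1
  ext x
  rw [edgeWeight_map hπ]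
  simp_rw [kernelWeight_map]
  have hx : MeasurableEquiv.piCongrLeft (fun _ => Λ) i x ∘ i = x :=
    funext fun v => Equiv.piCongrLeft_apply_apply (fun _ : V => Λ) i x v
  rw [hx]

/-- The integral of a diagram on two disjoint sets of vertices without edges between them is the
product of the integrals of the two parts. -/
theorem diagramIntegral_union [DecidableEq V] (μ : Measure Λ) [SigmaFinite μ] (K : Λ → ℝ)
    (hK : Function.Even K) {H H₁ H₂ : Type*} [DecidableEq H] {π : H → V} (Q : V → Prop)
    [DecidablePred Q] {π₁ : H₁ → {v // Q v}} {π₂ : H₂ → {v // ¬ Q v}} (j₁ : H₁ ↪ H) (j₂ : H₂ ↪ H)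
    (hπ₁ : ∀ h, π (j₁ h) = π₁ h) (hπ₂ : ∀ h, π (j₂ h) = π₂ h)
    (p₁ : Finset (Sym2 H₁)) (p₂ : Finset (Sym2 H₂))
    (hdisj : Disjoint (p₁.map j₁.sym2Map) (p₂.map j₂.sym2Map)) :
    diagramIntegral μ K hK π (p₁.map j₁.sym2Map ∪ p₂.map j₂.sym2Map) =
      diagramIntegral μ K hK π₁ p₁ * diagramIntegral μ K hK π₂ p₂ := by
  unfold diagramIntegral
  rw [← integral_prod_mul,
    ← (measurePreserving_piEquivPiSubtypeProd (fun _ : V => μ) Q).integral_comp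
    (MeasurableEquiv.measurableEmbedding _)]
  congr 1
  ext x
  rw [edgeWeight, Finset.prod_union hdisj]
  change edgeWeight _ _ _ * edgeWeight _ _ _ = _
  rw [edgeWeight_map (i := Subtype.val) hπ₁, edgeWeight_map (i := Subtype.val) hπ₂]
  simp_rw [kernelWeight_map]
  rfl

end Kernel

/-! ### Moments and cumulants of the Wick powers -/

section Moments

variable {V W : Type*} [Fintype V] [Fintype W]

open Classical in
/-- The sum of the diagram integrals of all pairings of half-edges, for vertices of arities `a`. -/
def pairingSum (μ : Measure Λ) (K : Λ → ℝ) (hK : Function.Even K) (a : V → ℕ) : ℝ :=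
  ∑ p ∈ pairings (Sigma.fst : (Σ v, Fin (a v)) → V) Finset.univ, diagramIntegral μ K hK Sigma.fst p

/-- The sum of the diagram integrals of the pairings forming a connected multigraph. -/
def connectedSum (μ : Measure Λ) (K : Λ → ℝ) (hK : Function.Even K) (a : V → ℕ) : ℝ :=
  ∑ p ∈ connectedPairings (Sigma.fst : (Σ v, Fin (a v)) → V) Finset.univ,
    diagramIntegral μ K hK Sigma.fst p

theorem integrable_prod_integratedWickPower (h : IsStationaryGaussianField X K P) (μ : Measure Λ)
    [IsFiniteMeasure μ] (a : V → ℕ) :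
    Integrable (fun ω => ∏ v, integratedWickPower μ P X (a v) ω) P := by
  have := h.isProbabilityMeasure
  simp_rw [prod_integratedWickPower]
  exact (h.integrable_prod_wickPower (Measure.pi fun _ : V => μ) a
    (y := fun v x => x v) fun v => measurable_pi_apply v).integral_prod_right

/-- The joint moments of the integrated Wick powers are sums over pairings. -/
theorem integral_prod_integratedWickPower (h : IsStationaryGaussianField X K P)
    (hK : Function.Even K) (μ : Measure Λ) [IsFiniteMeasure μ] (a : V → ℕ) :
    ∫ ω, ∏ v, integratedWickPower μ P X (a v) ω ∂P = pairingSum μ K hK a := by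
  classical
  have := h.isProbabilityMeasure
  simp_rw [prod_integratedWickPower]
  rw [← integral_integral_swap (h.integrable_prod_wickPower (Measure.pi fun _ : V => μ) a
    (y := fun v x => x v) fun v => measurable_pi_apply v)]
  have hx : ∀ x : V → Λ, ∫ ω, ∏ v, wickPower P X (a v) (x v) ω ∂P =
      ∑ p ∈ pairings (Sigma.fst : (Σ v, Fin (a v)) → V) Finset.univ,
        edgeWeight (kernelWeight K hK x) Sigma.fst p := by
    intro x
    rw [← integral_prod_hermiteVar_eq_sum_pairings (P := P) (fun v => h.hasAllMoments (x v))
      (h.steinPair x) (kernelWeight K hK x) (kernelWeight_mk K hK x)]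
    congr 1
    ext ω
    refine Finset.prod_congr rfl fun v _ => ?_
    rw [h.wickPower_eq, sub_self]
    congr 1
    rw [card_filter_fst_eq, Fintype.card_fin]
  simp_rw [hx]
  rw [integral_finsetSum _ fun p _ => integrable_edgeWeight h hK μ _ p]
  rw [pairingSum]
  rfl

/-- The sum over connected pairings depends only on the number of vertices of each arity. -/
theorem connectedSum_equiv (μ : Measure Λ) [SigmaFinite μ] (K : Λ → ℝ) (hK : Function.Even K)
    (a : V → ℕ) (b : W → ℕ) (e : V ≃ W) (he : ∀ v, b (e v) = a v) :
    connectedSum μ K hK b = connectedSum μ K hK a := by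
  classical
  let j : (Σ v, Fin (a v)) ≃ (Σ w, Fin (b w)) := Equiv.sigmaCongr e fun v => finCongr (he v).symm
  have hπ : ∀ h, Sigma.fst (j.toEmbedding h) = e.toEmbedding (Sigma.fst h) := fun h => rfl
  have h1 := connectedPairings_map hπ (fun h _ => j.surjective h) Finset.univ
  rw [connectedSum, show (Finset.univ : Finset W) = Finset.univ.map e.toEmbedding by simp, h1,
    Finset.sum_map]
  exact Finset.sum_congr rfl fun p _ => diagramIntegral_map_equiv μ K hK e j.toEmbedding hπ p

/-- Splitting off the connected component of a vertex factorises the sum over all pairings. -/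
theorem pairingSum_eq_sum [DecidableEq V] (μ : Measure Λ) [SigmaFinite μ] (K : Λ → ℝ)
    (hK : Function.Even K) (a : V → ℕ) (v : V) :
    pairingSum μ K hK a = ∑ S ∈ Finset.univ.filter (fun S : Finset V => v ∈ S),
      connectedSum μ K hK (fun w : {w // w ∈ S} => a w) *
        pairingSum μ K hK (fun w : {w // w ∉ S} => a w) := by
  classical
  rw [pairingSum, sum_pairings_eq_sum_component _ v]
  refine Finset.sum_congr rfl fun S _ => ?_
  let j : ∀ Q : V → Prop, (Σ w : {w // Q w}, Fin (a w)) ↪ Σ v, Fin (a v) := fun Q =>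
    ⟨fun h => ⟨h.1, h.2⟩, by
      rintro ⟨⟨v, hv⟩, i⟩ ⟨⟨w, hw⟩, k⟩ h
      simp only [Sigma.mk.injEq] at h
      obtain ⟨rfl, h⟩ := h
      rw [eq_of_heq h]⟩
  have hπ : ∀ (Q : V → Prop) (h : Σ w : {w // Q w}, Fin (a w)),
      Sigma.fst (j Q h) = Function.Embedding.subtype Q h.1 := fun Q h => rfl
  have hj : ∀ (Q : V → Prop) (h : Σ v, Fin (a v)),
      h.1 ∈ Set.range (Function.Embedding.subtype Q) → h ∈ Set.range (j Q) := by
    rintro Q ⟨v, i⟩ ⟨w, hw⟩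
    obtain rfl : w.1 = v := hw
    exact ⟨⟨w, i⟩, rfl⟩
  have h1 := connectedPairings_map (hπ (· ∈ S)) (hj (· ∈ S)) Finset.univ
  rw [show Finset.univ.map (Function.Embedding.subtype (· ∈ S)) = S by ext; simp] at h1
  have h2 := pairings_map (hπ (· ∉ S)) (halfEdgesAt Sigma.fst Finset.univ)
  rw [← halfEdgesAt_map (hπ (· ∉ S)) (hj (· ∉ S)) Finset.univ,
    show Finset.univ.map (Function.Embedding.subtype (· ∉ S)) = Sᶜ by ext; simp,
    halfEdgesAt_univ] at h2
  rw [h1, h2, Finset.sum_map, connectedSum, pairingSum, Finset.sum_mul_sum]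
  refine Finset.sum_congr rfl fun q hq => ?_
  rw [Finset.sum_map]
  refine Finset.sum_congr rfl fun r hr => ?_
  convert! diagramIntegral_union μ K hK (· ∈ S) (j (· ∈ S)) (j (· ∉ S)) (hπ (· ∈ S))
    (hπ (· ∉ S)) q r ?_
  have hq' := (mem_connectedPairings.1 (h1.symm ▸ Finset.mem_map_of_mem _ hq)).1
  have hr' := mem_pairings.1 (h2.symm ▸ Finset.mem_map_of_mem _ hr)
  exact hq'.disjoint hr' (disjoint_halfEdgesAt_compl _ S)

end Moments

end Field

/-! ### Vertices of prescribed arities -/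

/-- The arities are unbounded, but only finitely many of them occur. -/
instance PreVertex.fintype (m : ℕ →₀ ℕ) : Fintype (PreVertex m) :=
  Fintype.ofInjective
    (fun v => (⟨⟨v.1, Finsupp.mem_support_iff.2 fun h => (h ▸ v.2).elim0⟩, v.2⟩ :
      Σ k : m.support, Fin (m k)))
    fun v w h => by
      obtain ⟨k, i⟩ := v
      obtain ⟨l, j⟩ := w
      simp only [Sigma.mk.injEq, Subtype.mk.injEq] at h
      obtain ⟨rfl, h⟩ := h
      rw [eq_of_heq h]

theorem arityCount_apply {V : Type*} (a : V → ℕ) (S : Finset V) (k : ℕ) :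
    arityCount a S k = (S.filter fun v => a v = k).card := by
  rw [arityCount, Finsupp.finsetSum_apply, Finset.card_filter]
  exact Finset.sum_congr rfl fun v _ => Finsupp.single_apply

theorem prod_arityCount {V : Type*} (a : V → ℕ) (S : Finset V) (f : ℕ → ℝ) :
    ((arityCount a S).prod fun k b => f k ^ b) = ∏ v ∈ S, f (a v) := by
  rw [arityCount, ← Finsupp.prod_finsetSum_index (by simp) (by simp [pow_add])]
  exact Finset.prod_congr rfl fun v _ => by rw [Finsupp.prod_single_index (by simp), pow_one]

theorem arityCount_preVertex (m : ℕ →₀ ℕ) :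
    arityCount (Sigma.fst : PreVertex m → ℕ) Finset.univ = m := by
  ext k
  rw [arityCount_apply, card_filter_fst_eq, Fintype.card_fin]

/-- Vertices with arities `a` can be identified with those of a pre-Feynman diagram. -/
theorem exists_equiv_preVertex {V : Type*} [Fintype V] (a : V → ℕ) :
    ∃ e : V ≃ PreVertex (arityCount a Finset.univ), ∀ v, (e v).1 = a v := by
  have hcard : ∀ k, Fintype.card {v // a v = k} = arityCount a Finset.univ k := fun k => by
    rw [arityCount_apply, Fintype.card_subtype]
  refine ⟨(Equiv.sigmaFiberEquiv a).symm.trans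
    (Equiv.sigmaCongrRight fun k => Fintype.equivFinOfCardEq (hcard k)), fun v => rfl⟩

/-! ### Moment and cumulant generating series -/

section Series

variable {Λ Ω : Type*} [MeasurableSpace Λ] [MeasurableSpace Ω]

theorem coeffIntegral_linearForm (μ : Measure Λ) (P : Measure Ω) (X : Λ → Ω → ℝ) (ω : Ω) :
    coeffIntegral μ (fun x => linearForm fun k => wickPower P X k x ω) =
      linearForm fun k => integratedWickPower μ P X k ω := by
  ext m
  change ∫ x, MvPowerSeries.coeff m (linearForm fun k => wickPower P X k x ω) ∂μ = _
  by_cases hm : m.degree = 1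
  · obtain ⟨k, rfl⟩ : m ∈ Set.range fun k : ℕ => Finsupp.single k 1 := by
      rw [Finsupp.range_single_one]; exact hm
    simp_rw [coeff_linearForm_single]
    rfl
  · simp_rw [coeff_linearForm_of_degree_ne _ hm]
    exact integral_zero _ _

theorem egfCoeff_gibbsFactor (μ : Measure Λ) (P : Measure Ω) (X : Λ → Ω → ℝ) (ω : Ω)
    {V : Type*} [Fintype V] (a : V → ℕ) :
    egfCoeff (gibbsFactor μ P X ω) (arityCount a Finset.univ) =
      (-1) ^ Fintype.card V * ∏ v, integratedWickPower μ P X (a v) ω := by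
  have hneg : ∀ c : ℕ → ℝ, -linearForm c = linearForm fun k => -c k := by
    intro c
    ext m
    rw [map_neg]
    by_cases hm : m.degree = 1
    · obtain ⟨k, rfl⟩ : m ∈ Set.range fun k : ℕ => Finsupp.single k 1 := by
        rw [Finsupp.range_single_one]; exact hm
      simp_rw [coeff_linearForm_single]
    · simp_rw [coeff_linearForm_of_degree_ne _ hm, neg_zero]
  rw [egfCoeff, gibbsFactor, coeffIntegral_linearForm, hneg,
    multiFactorial_mul_coeff_formalExp_linearForm, prod_arityCount, Finset.prod_neg,
    Finset.card_univ]

variable [AddCommGroup Λ] {P : Measure Ω} {X : Λ → Ω → ℝ} {K : Λ → ℝ}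

theorem integrable_coeff_gibbsFactor (h : IsStationaryGaussianField X K P) (μ : Measure Λ)
    [IsFiniteMeasure μ] (m : ℕ →₀ ℕ) :
    Integrable (fun ω => MvPowerSeries.coeff m (gibbsFactor μ P X ω)) P := by
  have h1 := ((integrable_prod_integratedWickPower h μ (Sigma.fst : PreVertex m → ℕ)).const_mul
    ((-1) ^ Fintype.card (PreVertex m))).const_mul (multiFactorial m : ℝ)⁻¹
  refine h1.congr (.of_forall fun ω => ?_)
  have h2 := egfCoeff_gibbsFactor μ P X ω (Sigma.fst : PreVertex m → ℕ)
  rw [arityCount_preVertex] at h2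
  change _ * (_ * _) = _
  rw [← h2, egfCoeff, inv_mul_cancel_left₀ (Nat.cast_ne_zero.2 (multiFactorial_ne_zero m))]

/-- The moment generating series is the exponential generating function of all pairings. -/
theorem egfCoeff_coeffIntegral_gibbsFactor (h : IsStationaryGaussianField X K P)
    (hK : Function.Even K) (μ : Measure Λ) [IsFiniteMeasure μ] {V : Type*} [Fintype V]
    (a : V → ℕ) :
    egfCoeff (coeffIntegral P (gibbsFactor μ P X)) (arityCount a Finset.univ) =
      (-1) ^ Fintype.card V * pairingSum μ K hK a := by
  rw [← integral_prod_integratedWickPower h hK μ a, ← integral_const_mul, egfCoeff]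
  change _ * ∫ ω, MvPowerSeries.coeff _ (gibbsFactor μ P X ω) ∂P = _
  rw [← integral_const_mul]
  congr 1
  ext ω
  exact egfCoeff_gibbsFactor μ P X ω a

/-- The exponential generating function of the connected pairings. -/
def connectedSeries (μ : Measure Λ) (K : Λ → ℝ) (hK : Function.Even K) : MvPowerSeries ℕ ℝ :=
  fun m => (multiFactorial m : ℝ)⁻¹ * ((-1) ^ Fintype.card (PreVertex m) *
    connectedSum μ K hK (Sigma.fst : PreVertex m → ℕ))

theorem coeff_connectedSeries (μ : Measure Λ) (K : Λ → ℝ) (hK : Function.Even K) (m : ℕ →₀ ℕ) :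
    MvPowerSeries.coeff m (connectedSeries μ K hK) =
      (multiFactorial m : ℝ)⁻¹ * ((-1) ^ Fintype.card (PreVertex m) *
        connectedSum μ K hK (Sigma.fst : PreVertex m → ℕ)) := rfl

theorem egfCoeff_connectedSeries (μ : Measure Λ) [SigmaFinite μ] (K : Λ → ℝ)
    (hK : Function.Even K) {V : Type*} [Fintype V] (a : V → ℕ) :
    egfCoeff (connectedSeries μ K hK) (arityCount a Finset.univ) =
      (-1) ^ Fintype.card V * connectedSum μ K hK a := by
  obtain ⟨e, he⟩ := exists_equiv_preVertex a
  rw [egfCoeff, coeff_connectedSeries,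
    mul_inv_cancel_left₀ (Nat.cast_ne_zero.2 (multiFactorial_ne_zero _)),
    connectedSum_equiv μ K hK a Sigma.fst e he, Fintype.card_congr e]

theorem arityCount_subtype {V : Type*} (a : V → ℕ) (Q : V → Prop) [Fintype {v // Q v}]
    {S : Finset V} (hS : ∀ v, v ∈ S ↔ Q v) :
    arityCount (fun v : {v // Q v} => a v) Finset.univ = arityCount a S := by
  have : S = Finset.univ.map (Function.Embedding.subtype Q) := by
    ext v
    simp [hS]
  rw [this, arityCount, arityCount, Finset.sum_map]
  rfl

/-- The connected series is the logarithm of the moment generating series: it suffices to compare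
logarithmic derivatives, and `∂_k` of an exponential generating function marks a vertex of arity
`k`, whose connected component can be split off. -/
theorem formalLog_coeffIntegral_gibbsFactor (h : IsStationaryGaussianField X K P)
    (hK : Function.Even K) (μ : Measure Λ) [IsFiniteMeasure μ] :
    formalLog (coeffIntegral P (gibbsFactor μ P X)) = connectedSeries μ K hK := by
  classical
  have := h.isProbabilityMeasure
  have : IsEmpty (PreVertex 0) := ⟨fun v => v.2.elim0⟩
  refine formalLog_eq_of_pderiv ?_ ?_ fun k => ?_
  · have h1 := egfCoeff_coeffIntegral_gibbsFactor h hK μ (Sigma.fst : PreVertex 0 → ℕ)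
    rw [← integral_prod_integratedWickPower h hK μ, arityCount_preVertex, egfCoeff,
      multiFactorial_zero, Fintype.card_eq_zero, MvPowerSeries.coeff_zero_eq_constantCoeff_apply]
      at h1
    simpa using h1
  · rw [← MvPowerSeries.coeff_zero_eq_constantCoeff_apply, coeff_connectedSeries, connectedSum,
      Finset.sum_eq_zero, mul_zero, mul_zero]
    intro p hp
    obtain ⟨v, -⟩ := (mem_connectedPairings.1 hp).2.1
    exact isEmptyElim v
  · ext m
    refine mul_left_cancel₀ (Nat.cast_ne_zero.2 (multiFactorial_ne_zero m) : (_ : ℝ) ≠ 0) ?_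
    change egfCoeff _ m = egfCoeff _ m
    rw [egfCoeff_pderiv]
    set M := m + Finsupp.single k 1 with hM
    have hMk : 0 < M k := by simp [hM]
    let v : PreVertex M := ⟨k, ⟨0, hMk⟩⟩
    let a : PreVertex M → ℕ := Sigma.fst
    have hins : insert v (Finset.univ.erase v) = Finset.univ :=
      Finset.insert_erase (Finset.mem_univ v)
    have hm : arityCount a (Finset.univ.erase v) = m := by
      have h1 := arityCount_insert a (Finset.notMem_erase v Finset.univ)
      rw [hins, arityCount_preVertex] at h1
      exact (add_right_cancel h1).symm
    have hZ := egfCoeff_coeffIntegral_gibbsFactor h hK μ a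
    rw [arityCount_preVertex, pairingSum_eq_sum μ K hK a v, Finset.mul_sum] at hZ
    rw [hZ, ← hm, egfCoeff_mul]
    refine Finset.sum_bij' (fun S _ => S.erase v) (fun T _ => insert v T) ?_ ?_ ?_ ?_ ?_
    · intro S _
      exact Finset.mem_powerset.2 (Finset.erase_subset_erase v (Finset.subset_univ S))
    · simp
    · intro S hS
      exact Finset.insert_erase (Finset.mem_filter.1 hS).2
    · intro T hT
      exact Finset.erase_insert fun hv =>
        Finset.notMem_erase v _ (Finset.mem_powerset.1 hT hv)
    · intro S hS
      have hv := (Finset.mem_filter.1 hS).2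
      have e1 : arityCount a (S.erase v) + Finsupp.single k 1 = arityCount a S := by
        rw [← arityCount_insert a (Finset.notMem_erase v S), Finset.insert_erase hv]
      have e2 : Finset.univ.erase v \ S.erase v = Sᶜ := by
        ext w
        by_cases hw : w = v
        · subst hw; simp [hv]
        · simp [hw]
      rw [egfCoeff_pderiv, e1, e2, ← arityCount_subtype a (· ∈ S) (fun _ => Iff.rfl),
        ← arityCount_subtype a (· ∉ S) (fun _ => Finset.mem_compl), egfCoeff_connectedSeries,
        egfCoeff_coeffIntegral_gibbsFactor h hK μ, mul_mul_mul_comm, ← pow_add,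
        Fintype.card_subtype_compl, add_tsub_cancel_of_le (Fintype.card_subtype_le _)]

end Series

/-! ### Feynman diagrams -/

/-- In a pairing without self-contractions the number of edges at `v` is the number of its
half-edges. -/
theorem IsPairingOn.card_filter_mem {H V : Type*} [DecidableEq V] {π : H → V} {T : Finset H}
    {p : Finset (Sym2 H)} (hp : IsPairingOn π T p) (v : V) :
    (p.filter fun e => v ∈ e.map π).card = (T.filter fun h => π h = v).card := by
  choose g hg using fun h hh => (hp.2.1 h hh).exists
  symm
  have hT : ∀ h ∈ T.filter fun h => π h = v, h ∈ T := fun h hh => (Finset.mem_filter.1 hh).1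
  have hv : ∀ h ∈ T.filter fun h => π h = v, π h = v := fun h hh => (Finset.mem_filter.1 hh).2
  refine Finset.card_bij (fun h hh => g h (hT h hh)) (fun h hh => ?_)
    (fun h hh h' hh' heq => ?_) fun e he => ?_
  · exact Finset.mem_filter.2 ⟨(hg h _).1, Sym2.mem_map.2 ⟨h, (hg h _).2, hv h hh⟩⟩
  · by_contra hne
    have h1 := (hg h (hT h hh)).2
    have h2 := heq ▸ (hg h' (hT h' hh')).2
    have he : g h (hT h hh) = s(h, h') := (Sym2.mem_and_mem_iff hne).1 ⟨h1, h2⟩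
    exact hp.2.2 _ (hg h (hT h hh)).1 (by simp [he, hv h hh, hv h' hh'])
  · obtain ⟨hep, hve⟩ := Finset.mem_filter.1 he
    obtain ⟨h, hh, rfl⟩ := Sym2.mem_map.1 hve
    have hT := hp.1 e hep h hh
    exact ⟨h, Finset.mem_filter.2 ⟨hT, rfl⟩, hp.eq_of_mem (hg h hT).1 hep (hg h hT).2 hh⟩

theorem isPairing_iff {m : ℕ →₀ ℕ} {p : Finset (Sym2 (HalfEdge m))} :
    IsPairing p ↔ IsPairingOn (Sigma.fst : HalfEdge m → PreVertex m) Finset.univ p := by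
  simp [IsPairing, IsPairingOn]

theorem mem_pairingEdges {m : ℕ →₀ ℕ} {p : Finset (Sym2 (HalfEdge m))} {e : Sym2 (PreVertex m)} :
    e ∈ pairingEdges p ↔ ∃ e' ∈ p, e'.map Sigma.fst = e := by
  simp [pairingEdges]

/-- Connectedness of a pairing is graph-theoretic connectedness of its multigraph. -/
theorem isConnectedOn_univ_iff {m : ℕ →₀ ℕ} {p : Finset (Sym2 (HalfEdge m))} :
    IsConnectedOn (Sigma.fst : HalfEdge m → PreVertex m) Finset.univ p ↔
      (SimpleGraph.fromEdgeSet {e | e ∈ pairingEdges p}).Connected := by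
  classical
  set G := SimpleGraph.fromEdgeSet {e | e ∈ pairingEdges p} with hG
  constructor
  · rintro ⟨⟨v₀, -⟩, hc⟩
    have : Nonempty (PreVertex m) := ⟨v₀⟩
    refine SimpleGraph.Connected.mk fun v w => ?_
    have h1 := hc (Finset.univ.filter fun w => G.Reachable v w) (Finset.subset_univ _)
      ⟨v, by simp⟩ ?_
    · have : w ∈ Finset.univ.filter fun w => G.Reachable v w := by rw [h1]; exact Finset.mem_univ w
      exact (Finset.mem_filter.1 this).2
    · intro e he h hh hv h' hh'
      rw [Finset.mem_filter] at hv ⊢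
      refine ⟨Finset.mem_univ _, hv.2.trans ?_⟩
      by_cases hne : h.1 = h'.1
      · rw [hne]
      · refine SimpleGraph.Adj.reachable ?_
        rw [hG, SimpleGraph.fromEdgeSet_adj]
        have hne' : h ≠ h' := fun h0 => hne (by rw [h0])
        refine ⟨mem_pairingEdges.2 ⟨e, he, ?_⟩, hne⟩
        rw [(Sym2.mem_and_mem_iff hne').1 ⟨hh, hh'⟩, Sym2.map_mk]
  · intro hc
    have := hc.nonempty
    refine ⟨Finset.univ_nonempty, fun U _ ⟨u, hu⟩ hsat => Finset.eq_univ_iff_forall.2 fun w => ?_⟩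
    obtain ⟨walk⟩ := hc.preconnected u w
    induction walk with
    | nil => exact hu
    | cons hadj _ ih =>
      refine ih ?_
      rw [hG, SimpleGraph.fromEdgeSet_adj] at hadj
      obtain ⟨e, he, hem⟩ := mem_pairingEdges.1 hadj.1
      have hu' := Sym2.mem_map.1 (hem ▸ Sym2.mem_mk_left _ _)
      have hv' := Sym2.mem_map.1 (hem ▸ Sym2.mem_mk_right _ _)
      obtain ⟨h, hh, rfl⟩ := hu'
      obtain ⟨h', hh', rfl⟩ := hv'
      exact hsat e he h hh hu h' hh'

theorem EdgesIso.connected {V W : Type*} {E : Multiset (Sym2 V)} {E' : Multiset (Sym2 W)}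
    (h : EdgesIso E E') (hc : (SimpleGraph.fromEdgeSet {e | e ∈ E}).Connected) :
    (SimpleGraph.fromEdgeSet {e | e ∈ E'}).Connected := by
  obtain ⟨f, rfl⟩ := h
  let φ : SimpleGraph.fromEdgeSet {e | e ∈ E} ≃g
      SimpleGraph.fromEdgeSet {e | e ∈ E.map (Sym2.map f)} :=
    { toEquiv := f
      map_rel_iff' := by
        intro v w
        have : s(f v, f w) ∈ E.map (Sym2.map f) ↔ s(v, w) ∈ E := by
          rw [← Sym2.map_mk]
          exact Multiset.mem_map_of_injective (Sym2.map.injective f.injective)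
        simp [SimpleGraph.fromEdgeSet_adj] at this ⊢
        exact fun _ => this }
  exact φ.connected_iff.1 hc

namespace LabelledDiagram

theorem counting_eq_arityCount (Γ : LabelledDiagram) :
    Γ.counting = arityCount Γ.arity Finset.univ := rfl

/-- Every connected pairing forms a labelled diagram with the prescribed arities. -/
theorem exists_of_mem_connectedPairings {m : ℕ →₀ ℕ} {p : Finset (Sym2 (HalfEdge m))}
    (hp : p ∈ connectedPairings (Sigma.fst : HalfEdge m → PreVertex m) Finset.univ) :
    ∃ Γ : LabelledDiagram, Γ.counting = m ∧ EdgesIso (pairingEdges p) Γ.edges := by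
  classical
  obtain ⟨hp, hc⟩ := mem_connectedPairings.1 hp
  rw [halfEdgesAt_univ] at hp
  let f := Fintype.equivFin (PreVertex m)
  have hiso : EdgesIso (pairingEdges p) ((pairingEdges p).map (Sym2.map f)) := ⟨f, rfl⟩
  let Γ : LabelledDiagram :=
    { n := Fintype.card (PreVertex m)
      edges := (pairingEdges p).map (Sym2.map f)
      loopless := by
        intro e he
        obtain ⟨e', he', rfl⟩ := Multiset.mem_map.1 he
        obtain ⟨e'', he'', rfl⟩ := mem_pairingEdges.1 he'
        have := hp.2.2 e'' he''
        induction e'' with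
        | _ h h' => simpa using this
      connected := hiso.connected (isConnectedOn_univ_iff.1 hc) }
  refine ⟨Γ, ?_, hiso⟩
  have harity : ∀ v, Γ.arity (f v) = v.1 := by
    intro v
    have h1 : Γ.arity (f v) = (p.filter fun e => v ∈ e.map Sigma.fst).card := by
      change ((p.val.map (Sym2.map Sigma.fst)).map (Sym2.map f)).countP (fun e => f v ∈ e) = _
      rw [Multiset.countP_map, Multiset.filter_map, Multiset.card_map, Finset.card_def,
        Finset.filter_val]
      congr 1
      refine Multiset.filter_congr fun e _ => ?_
      simp [Sym2.mem_map]
    rw [h1, hp.card_filter_mem v]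
    rw [card_filter_fst_eq, Fintype.card_fin]
  rw [counting_eq_arityCount, ← arityCount_preVertex m]
  symm
  refine Fintype.sum_equiv f _ _ fun v => ?_
  rw [harity]

/-- A pairing whose multigraph is isomorphic to a connected diagram is connected, so that `N(Γ)`
counts connected pairings only. -/
theorem numPairings_eq_card {Γ : LabelledDiagram} {m : ℕ →₀ ℕ} (hm : Γ.counting = m)
    [DecidablePred fun p : Finset (Sym2 (HalfEdge m)) => EdgesIso (pairingEdges p) Γ.edges] :
    Γ.numPairings = ((connectedPairings (Sigma.fst : HalfEdge m → PreVertex m)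
      Finset.univ).filter fun p => EdgesIso (pairingEdges p) Γ.edges).card := by
  subst hm
  refine Nat.subtype_card _ fun p => ?_
  rw [Finset.mem_filter, mem_connectedPairings, halfEdgesAt_univ, isPairing_iff, and_assoc]
  refine and_congr_right fun _ => and_iff_right_of_imp fun h => ?_
  exact isConnectedOn_univ_iff.2 (h.symm.connected Γ.connected)

/-- The integral of a pairing is the valuation of the diagram that it forms. -/
theorem diagramIntegral_eq_valuation {Λ : Type*} [AddCommGroup Λ] [MeasurableSpace Λ]
    (μ : Measure Λ) [SigmaFinite μ] (K : Λ → ℝ) (hK : Function.Even K) {Γ : LabelledDiagram}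
    {m : ℕ →₀ ℕ} {p : Finset (Sym2 (HalfEdge m))} (hp : EdgesIso (pairingEdges p) Γ.edges) :
    diagramIntegral μ K hK (Sigma.fst : HalfEdge m → PreVertex m) p = Γ.valuation μ K hK := by
  obtain ⟨f, hf⟩ := hp
  unfold valuation diagramIntegral
  rw [← (measurePreserving_piCongrLeft (fun _ : Fin Γ.n => μ) f).integral_comp
    (MeasurableEquiv.measurableEmbedding _)]
  congr 1
  ext x
  have hx : MeasurableEquiv.piCongrLeft (fun _ => Λ) f x ∘ f = x :=
    funext fun v => Equiv.piCongrLeft_apply_apply (fun _ : Fin Γ.n => Λ) f x v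
  change _ = (Γ.edges.map (kernelWeight K hK (MeasurableEquiv.piCongrLeft (fun _ => Λ) f x))).prod
  rw [← hf, Multiset.map_map, pairingEdges, Multiset.map_map]
  change (p.val.map fun e => kernelWeight K hK x (e.map Sigma.fst)).prod = _
  simp only [Function.comp_apply, kernelWeight_map, hx]

theorem card_eq_degree (Γ : LabelledDiagram) : Γ.n = Γ.counting.degree := by
  rw [counting, map_sum]
  simp

theorem arity_le (Γ : LabelledDiagram) (v : Fin Γ.n) :
    Γ.arity v ≤ Γ.counting.support.sup id := by
  refine Finset.le_sup (f := id) (Finsupp.mem_support_iff.2 ?_)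
  rw [counting_eq_arityCount, arityCount_apply]
  exact Finset.card_ne_zero.2 ⟨v, Finset.mem_filter.2 ⟨Finset.mem_univ v, rfl⟩⟩

end LabelledDiagram

namespace FeynmanDiagram

/-- The isomorphism class of a labelled diagram. -/
def ofLabelled (Γ : LabelledDiagram) : FeynmanDiagram := Quotient.mk _ Γ

theorem ofLabelled_surjective (Γ : FeynmanDiagram) : ∃ Γ', ofLabelled Γ' = Γ :=
  Quotient.exists_rep Γ

theorem ofLabelled_eq_iff {Γ Γ' : LabelledDiagram} :
    ofLabelled Γ = ofLabelled Γ' ↔ EdgesIso Γ.edges Γ'.edges :=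
  ⟨fun h => Quotient.exact h, fun h => Quotient.sound h⟩

theorem N_ofLabelled (Γ : LabelledDiagram) : (ofLabelled Γ).N = Γ.numPairings := rfl

theorem valuation_ofLabelled {Λ : Type*} [AddCommGroup Λ] [MeasurableSpace Λ] (μ : Measure Λ)
    [SigmaFinite μ] (K : Λ → ℝ) (hK : Function.Even K) (Γ : LabelledDiagram) :
    (ofLabelled Γ).valuation μ K hK = Γ.valuation μ K hK := rfl

/-- There are finitely many diagrams with given arities: the number of vertices is determined and
the multiplicity of each edge is bounded by the largest arity. -/
theorem finite_setOf_β_eq (m : ℕ →₀ ℕ) : {Γ : FeynmanDiagram | Γ.β = m}.Finite := by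
  classical
  -- edge multisets of connected loopless multigraphs on the determined number of vertices
  let D := {E : Multiset (Sym2 (Fin m.degree)) // (∀ e ∈ E, ¬ e.IsDiag) ∧
    (SimpleGraph.fromEdgeSet {e | e ∈ E}).Connected}
  let g : D → FeynmanDiagram := fun E => ofLabelled ⟨m.degree, E.1, E.2.1, E.2.2⟩
  let B := m.support.sup id
  have hfin : {E : D |
      E.1 ∈ Set.Icc 0 (B • (Finset.univ : Finset (Sym2 (Fin m.degree))).val)}.Finite :=
    Set.Finite.preimage Subtype.val_injective.injOn (Set.finite_Icc _ _)
  refine (hfin.image g).subset fun Γ hΓ => ?_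
  obtain ⟨Γ, rfl⟩ := ofLabelled_surjective Γ
  replace hΓ : Γ.counting = m := hΓ
  have hn : Γ.n = m.degree := by rw [Γ.card_eq_degree, hΓ]
  have hB : ∀ v, Γ.arity v ≤ B := fun v => by
    have := Γ.arity_le v
    rwa [hΓ] at this
  obtain ⟨n, E, hl, hc⟩ := Γ
  dsimp only at hn
  subst hn
  refine ⟨⟨E, hl, hc⟩, ⟨Multiset.zero_le _, Multiset.le_iff_count.2 fun e => ?_⟩, rfl⟩
  rw [Multiset.count_nsmul, Multiset.count_eq_one_of_mem (Finset.nodup _) (Finset.mem_univ e),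
    mul_one]
  induction e with
  | _ v w =>
    refine le_trans ?_ (hB v)
    rw [Multiset.count, LabelledDiagram.arity, Multiset.countP_eq_card_filter,
      Multiset.countP_eq_card_filter]
    refine Multiset.card_le_card (Multiset.monotone_filter_right E fun e he => ?_)
    rw [← he]
    exact Sym2.mem_mk_left v w

theorem coeff_upsilon (Γ : FeynmanDiagram) (m : ℕ →₀ ℕ) :
    MvPowerSeries.coeff m Γ.upsilon =
      if Γ.β = m then (-1) ^ Fintype.card (PreVertex m) else 0 := by
  classical
  have h1 : Γ.upsilon = ((MvPolynomial.monomial Γ.β (Γ.β.prod fun _ b => (-1 : ℝ) ^ b) :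
      MvPolynomial ℕ ℝ) : MvPowerSeries ℕ ℝ) := by
    rw [MvPolynomial.monomial_eq, MvPolynomial.coe_mul, MvPolynomial.coe_C, upsilon]
    simp only [Finsupp.prod, map_prod, neg_pow (MvPowerSeries.X _), Finset.prod_mul_distrib,
      map_pow, map_neg, map_one]
    congr 1
    rw [← MvPolynomial.coeToMvPowerSeries.ringHom_apply, map_prod]
    simp
  rw [h1, MvPolynomial.coeff_coe, MvPolynomial.coeff_monomial]
  split_ifs with hm
  swap
  · rfl
  subst hm
  have h2 := prod_arityCount (Sigma.fst : PreVertex Γ.β → ℕ) Finset.univ fun _ => -1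
  rw [arityCount_preVertex, Finset.prod_const, Finset.card_univ] at h2
  exact h2

theorem sHat_eq_multiFactorial (Γ : FeynmanDiagram) : Γ.sHat = multiFactorial Γ.β := rfl

/-- Sorting the connected pairings by the isomorphism class of their multigraph. -/
theorem sum_N_mul_valuation {Λ : Type*} [AddCommGroup Λ] [MeasurableSpace Λ] (μ : Measure Λ)
    [SigmaFinite μ] (K : Λ → ℝ) (hK : Function.Even K) (m : ℕ →₀ ℕ) :
    ∑ Γ ∈ (finite_setOf_β_eq m).toFinset, (Γ.N : ℝ) * Γ.valuation μ K hK =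
      connectedSum μ K hK (Sigma.fst : PreVertex m → ℕ) := by
  classical
  choose g hgm hg using fun p : {p // p ∈ connectedPairings
    (Sigma.fst : HalfEdge m → PreVertex m) Finset.univ} =>
    LabelledDiagram.exists_of_mem_connectedPairings p.2
  rw [connectedSum, ← Finset.sum_attach (connectedPairings _ _), ← Finset.sum_fiberwise_of_maps_to
    (g := fun p => ofLabelled (g p)) (t := (finite_setOf_β_eq m).toFinset)
    (fun p _ => (finite_setOf_β_eq m).mem_toFinset.2 (hgm p))]
  refine Finset.sum_congr rfl fun Γ hΓ => ?_
  rw [Set.Finite.mem_toFinset] at hΓ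
  obtain ⟨Γ, rfl⟩ := ofLabelled_surjective Γ
  replace hΓ : Γ.counting = m := hΓ
  have hiff : ∀ p, ofLabelled (g p) = ofLabelled Γ ↔ EdgesIso (pairingEdges p.1) Γ.edges :=
    fun p => ofLabelled_eq_iff.trans ⟨(hg p).trans, (hg p).symm.trans⟩
  rw [Finset.sum_congr rfl fun p hp => LabelledDiagram.diagramIntegral_eq_valuation μ K hK
    ((hiff p).1 (Finset.mem_filter.1 hp).2), Finset.sum_const, nsmul_eq_mul, N_ofLabelled,
    valuation_ofLabelled, LabelledDiagram.numPairings_eq_card hΓ]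
  congr 2
  simp only [hiff]
  rw [← Finset.card_map (Function.Embedding.subtype _)]
  congr 1
  ext p
  simp [and_comm]

end FeynmanDiagram

end

theorem lemma4p5 {Λ Ω : Type*} [AddCommGroup Λ] [MeasurableSpace Λ] [MeasurableSpace Ω]
    (μ : Measure Λ) [IsFiniteMeasure μ] (P : Measure Ω) [IsProbabilityMeasure P]
    (X : Λ → Ω → ℝ) (hX : Measurable (Function.uncurry X)) (hGauss : IsGaussianProcess X P)
    (hmean : ∀ x, ∫ ω, X x ω ∂P = 0)
    (K : Λ → ℝ) (hK : Function.Even K)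
    (hcov : ∀ x y, ∫ ω, X x ω * X y ω ∂P = K (x - y)) :
    (∀ k, ∀ᵐ ω ∂P, Integrable (fun x => wickPower P X k x ω) μ) ∧
    (∀ m : ℕ →₀ ℕ, Integrable (fun ω => MvPowerSeries.coeff m (gibbsFactor μ P X ω)) P) ∧
    (∀ Γ : LabelledDiagram, Integrable (Γ.integrand K hK) (Measure.pi fun _ => μ)) ∧
    (∀ m : ℕ →₀ ℕ, {Γ : FeynmanDiagram | Γ.β = m}.Finite) ∧
    HasSum
      (fun Γ : FeynmanDiagram =>
        ((Γ.N : ℝ) / (Γ.sHat : ℝ) * Γ.valuation μ K hK) • Γ.upsilon)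
      (formalLog (coeffIntegral P (gibbsFactor μ P X))) := by
  have h : IsStationaryGaussianField X K P := ⟨hX, hGauss, hmean, hcov⟩
  refine ⟨fun k => (h.integrable_wickPower μ k).prod_left_ae, integrable_coeff_gibbsFactor h μ,
    fun Γ => integrable_prod_kernelWeight h hK μ Γ.edges, FeynmanDiagram.finite_setOf_β_eq, ?_⟩
  rw [formalLog_coeffIntegral_gibbsFactor h hK μ,
    MvPowerSeries.WithPiTopology.hasSum_iff_hasSum_coeff]
  intro m
  -- only the finitely many diagrams with arities `m` contribute to the coefficient of `α^m`
  have h0 : ∀ Γ ∉ (FeynmanDiagram.finite_setOf_β_eq m).toFinset, MvPowerSeries.coeff m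
      (((Γ.N : ℝ) / (Γ.sHat : ℝ) * Γ.valuation μ K hK) • Γ.upsilon) = 0 := by
    intro Γ hΓ
    have hne : Γ.β ≠ m := by simpa using hΓ
    rw [MvPowerSeries.coeff_smul, FeynmanDiagram.coeff_upsilon, if_neg hne, mul_zero]
  suffices H : MvPowerSeries.coeff m (connectedSeries μ K hK) = _ from
    H ▸ hasSum_sum_of_ne_finset_zero h0
  rw [coeff_connectedSeries, ← FeynmanDiagram.sum_N_mul_valuation, Finset.mul_sum, Finset.mul_sum]
  refine Finset.sum_congr rfl fun Γ hΓ => ?_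
  have heq : Γ.β = m := by simpa using hΓ
  rw [MvPowerSeries.coeff_smul, FeynmanDiagram.coeff_upsilon, if_pos heq,
    FeynmanDiagram.sHat_eq_multiFactorial, heq]
  ring
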